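/- Consider $n$ sensors clustered into $K$ types, with $n_k\ge 1$ sensors of type $k$, $\sum_k n_k=n$. A sample of a type-$k$ sensor has distribution $p_{0,k}$ if the sensor is unaffected and $p_{1,k}$ if it is affected by the anomaly. At each time $t\ge1$ the data vector $X^n[t]$ has independent entries, received in an unknown arbitrary order; data vectors at different times are independent. Before the change-point $\nu$ no sensor is affected ($S[t]=0$ for $t<\nu$); at each time $t\ge\nu$ exactly one sensor is affected, of type $S[t]\in\{1,\dots,K\}$, and the trajectory $\boldsymbol S=(S[t])_t$ is arbitrary. For $s\in\{0,1,\dots,K\}$ let $\mathcal S_{n,s}$ be the set of label functions that assign the $n$ entries to their groups: for $s=0$, $n_k$ entries have distribution $p_{0,k}$ for each $k$; for $s\ge1$, $n_s-1$ entries have distribution $p_{0,s}$, one has $p_{1,s}$, and $n_k$ entries have $p_{0,k}$ for each $k\ne s$. For $\sigma\in\mathcal S_{n,s}$ let $\mathbb P^s_\sigma$ be the corresponding product law of $X^n$. Let $\Omega_{\boldsymbol S}=(\sigma_t)_{t\ge1}$, $\sigma_t\in\mathcal S_{n,S[t]}$, be a sequence of labels, $\mathbb E^{\boldsymbol S,\nu}_{\Omega_{\boldsymbol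 S}}$ the expectation when $X^n[t]\sim\mathbb P^{S[t]}_{\sigma_t}$ for all $t$, and $\mathbb E^\infty_\Omega$ the expectation when there is no change. For a stopping time $\tau$ of the observations put $$\mathrm{WADD}(\tau)=\sup_{\nu\ge1}\sup_{\boldsymbol S}\sup_{\Omega_{\boldsymbol S}}\operatorname{ess\,sup}\,\mathbb E^{\boldsymbol S,\nu}_{\Omega_{\boldsymbol S}}\big[(\tau-\nu)^+\mid X^n[1],\dots,X^n[\nu-1]\big],\qquad \mathrm{WARL}(\tau)=\inf_{\Omega}\mathbb E^\infty_{\Omega}[\tau].$$ Let $\widetilde{\mathbb P}_0$ and $\widetilde{\mathbb P}^k$ be the uniform mixtures $\frac1{|\mathcal S_{n,s}|}\sum_{\sigma\in\mathcal S_{n,s}}\mathbb P^s_\sigma$ for $s=0$ and $s=k$. For a probability vector $\boldsymbol\beta$ on $\{1,\dots,K\}$ let $\widetilde{\mathbb P}^{\boldsymbol\beta}=\sum_k\beta_k\widetilde{\mathbb P}^k$ and $I_{\boldsymbol\beta}=D(\widetilde{\mathbb P}^{\boldsymbol\beta}\|\widetilde{\mathbb P}_0)$ (Kullback--Leibler divergence).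 Assume $D(\widetilde{\mathbb P}^k\|\widetilde{\mathbb P}_0)<\infty$ for every $k$. Let $\boldsymbol\beta^*$ be any minimizer of $I_{\boldsymbol\beta}$, and assume $I_{\boldsymbol\beta^*}>0$. With $\ell_{\boldsymbol\beta^*}=\log\big(d\widetilde{\mathbb P}^{\boldsymbol\beta^*}/d\widetilde{\mathbb P}_0\big)$ (where $\log0=-\infty$) let $$T_{\boldsymbol\beta^*}(b)=\inf\Big\{t\ge1:\ \max_{1\le j\le t+1}\sum_{i=j}^t\ell_{\boldsymbol\beta^*}(X^n[i])\ge b\Big\}.$$ Then $T_{\boldsymbol\beta^*}$ is first-order asymptotically optimal for minimizing $\mathrm{WADD}(\tau)$ over the stopping times $\tau$ with $\mathrm{WARL}(\tau)\ge\gamma$. That is, with the threshold $b=\log\gamma$: for every $\gamma>0$, $T_{\boldsymbol\beta^*}(\log\gamma)$ is a stopping time with $\mathrm{WARL}(T_{\boldsymbol\beta^*}(\log\gamma))\ge\gamma$; and, as $\gamma\to\infty$, $$\mathrm{WADD}(T_{\boldsymbol\beta^*}(\log\gamma))=\frac{\log\gamma}{I_{\boldsymbol\beta^*}}(1+o(1)),\qquad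 \inf_{\tau:\,\mathrm{WARL}(\tau)\ge\gamma}\mathrm{WADD}(\tau)=\frac{\log\gamma}{I_{\boldsymbol\beta^*}}(1+o(1)),$$ so that the ratio of the two tends to $1$. -/

import Mathlib

open MeasureTheory ProbabilityTheory Filter Topology
open scoped ENNReal

noncomputable section

/-- A network of `n` sensors clustered into `K` types. There are `count k ≥ 1` sensors of type `k`;
a sample of an unaffected (affected) sensor of type `k` has law `pre k` (`post k`). -/
structure SensorNetwork (𝒳 : Type*) [MeasurableSpace 𝒳] (K n : ℕ) where
  count : Fin K → ℕ
  count_pos : ∀ k, 1 ≤ count k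
  count_sum : ∑ k, count k = n
  pre : Fin K → Measure 𝒳
  post : Fin K → Measure 𝒳
  pre_prob : ∀ k, IsProbabilityMeasure (pre k)
  post_prob : ∀ k, IsProbabilityMeasure (post k)

/-- Infinite observation sequences. The data vector received at time `t = 1, 2, 3, …` is
the coordinate with index `t - 1`, see `SensorNetwork.obs`. -/
abbrev ObsSeq (𝒳 : Type*) (n : ℕ) : Type _ := ℕ → Fin n → 𝒳

namespace SensorNetwork

variable {𝒳 : Type*} [MeasurableSpace 𝒳] {K n : ℕ}

/-- The data vector `X^n[t]` received at time `t ≥ 1`. -/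
def obs (ω : ObsSeq 𝒳 n) (t : ℕ) : Fin n → 𝒳 := ω (t - 1)

/-- The information available at time `t`: the σ-algebra generated by `X^n[1], …, X^n[t]`
(trivial for `t = 0`). -/
def obsFiltration (𝒳 : Type*) [MeasurableSpace 𝒳] (n : ℕ) :
    Filtration ℕ (inferInstance : MeasurableSpace (ObsSeq 𝒳 n)) where
  seq t := ⨆ s : ℕ, ⨆ _ : s < t,
    MeasurableSpace.comap (fun ω : ObsSeq 𝒳 n => ω s) inferInstance
  mono' _ _ hij := iSup_mono fun _ => iSup_mono' fun h => ⟨lt_of_lt_of_le h hij, le_rfl⟩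
  le' _ := iSup_le fun s => iSup_le fun _ => (measurable_pi_apply s).comap_le

variable (M : SensorNetwork 𝒳 K n)

/-- Number of samples in each group when the type of the affected sensor is `s` (`none` if there is
no anomaly). The group `Sum.inl k` holds the unaffected sensors of type `k`, the group `Sum.inr k`
the affected ones. -/
def groupSize (s : Option (Fin K)) : Fin K ⊕ Fin K → ℕ
  | Sum.inl k => if s = some k then M.count k - 1 else M.count k
  | Sum.inr k => if s = some k then 1 else 0

open Classical in
/-- The admissible label functions (sample index to group) when the affected type is `s`. -/
def labels (s : Option (Fin K)) : Finset (Fin n → Fin K ⊕ Fin K) :=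
  {σ | ∀ g, (Finset.univ.filter fun i => σ i = g).card = M.groupSize s g}

/-- The law of a data vector with label function `σ`: independent entries, the `i`-th one with
the law of the group `σ i`. -/
def sampleLaw (σ : Fin n → Fin K ⊕ Fin K) : Measure (Fin n → 𝒳) :=
  Measure.pi fun i => Sum.elim M.pre M.post (σ i)

/-- The uniform mixture of the laws `sampleLaw σ` over all admissible labels: the pre-change mixture
for `s = none`, the post-change mixture of type `k` for `s = some k`. -/
def mixture (s : Option (Fin K)) : Measure (Fin n → 𝒳) :=
  ((M.labels s).card : ℝ≥0∞)⁻¹ • ∑ σ ∈ M.labels s, M.sampleLaw σ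

/-- The `β`-weighted mixture of the post-change mixtures. -/
def weightedMixture (β : Fin K → ℝ) : Measure (Fin n → 𝒳) :=
  ∑ k, ENNReal.ofReal (β k) • M.mixture (some k)

/-- `I_β`, the Kullback-Leibler divergence of the `β`-weighted mixture from the pre-change one. -/
def weightedDiv (β : Fin K → ℝ) : ℝ≥0∞ :=
  InformationTheory.klDiv (M.weightedMixture β) (M.mixture none)

/-- `β` is a weight vector that minimizes `I_β`. -/
def IsOptimalWeight (β : Fin K → ℝ) : Prop :=
  β ∈ stdSimplex ℝ (Fin K) ∧ IsMinOn M.weightedDiv (stdSimplex ℝ (Fin K)) β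

/-- The law of the observation sequence when the data vector at time `t ≥ 1` has label `Ω t` and
data vectors at different times are independent. -/
def seqLaw (Ω : ℕ → Fin n → Fin K ⊕ Fin K) : Measure (ObsSeq 𝒳 n) :=
  Measure.infinitePi fun s => M.sampleLaw (Ω (s + 1))

/-- `S` is a trajectory of an anomaly with change-point `ν`: a sensor is affected
exactly at the times `t ≥ ν`, and the type of the affected sensor is arbitrary. -/
def IsTrajectory (ν : ℕ) (S : ℕ → Option (Fin K)) : Prop :=
  ∀ t, 1 ≤ t → (S t = none ↔ t < ν)

/-- `Ω` is an admissible sequence of labels for the trajectory `S`. -/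
def IsLabelSeq (S : ℕ → Option (Fin K)) (Ω : ℕ → Fin n → Fin K ⊕ Fin K) : Prop :=
  ∀ t, 1 ≤ t → Ω t ∈ M.labels (S t)

/-- Worst-case average detection delay, over all change-points, trajectories, labels
and pasts. -/
def wadd (τ : ObsSeq 𝒳 n → ℕ∞) : ℝ≥0∞ :=
  ⨆ (ν : ℕ) (_ : 1 ≤ ν) (S : ℕ → Option (Fin K)) (_ : IsTrajectory ν S)
    (Ω : ℕ → Fin n → Fin K ⊕ Fin K) (_ : M.IsLabelSeq S Ω),
    essSup (condLExp (obsFiltration 𝒳 n (ν - 1)) (M.seqLaw Ω)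
      (fun ω => ((τ ω - (ν : ℕ∞) : ℕ∞) : ℝ≥0∞))) (M.seqLaw Ω)

/-- Worst-case average running length, over all pre-change labels. -/
def warl (τ : ObsSeq 𝒳 n → ℕ∞) : ℝ≥0∞ :=
  ⨅ (Ω : ℕ → Fin n → Fin K ⊕ Fin K) (_ : M.IsLabelSeq (fun _ => none) Ω),
    ∫⁻ ω, (τ ω : ℝ≥0∞) ∂(M.seqLaw Ω)

/-- The stopping times whose worst-case average running length is at least `γ`. -/
def feasible (γ : ℝ) : Set (ObsSeq 𝒳 n → ℕ∞) :=
  {τ | IsStoppingTime (obsFiltration 𝒳 n) τ ∧ ENNReal.ofReal γ ≤ M.warl τ}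

/-- The least worst-case delay under the constraint on the worst-case running length. -/
def optimalWadd (γ : ℝ) : ℝ≥0∞ := ⨅ τ ∈ M.feasible γ, M.wadd τ

/-- The weighted mixture log-likelihood ratio, with `log 0 = -∞`. -/
def logRatio (β : Fin K → ℝ) (x : Fin n → 𝒳) : EReal :=
  ENNReal.log ((M.weightedMixture β).rnDeriv (M.mixture none) x)

/-- The weighted mixture CuSum statistic at time `t`; the empty sum for `j = t + 1` is `0`. -/
def cusumStat (β : Fin K → ℝ) (t : ℕ) (ω : ObsSeq 𝒳 n) : EReal :=
  ⨆ j ∈ Finset.Icc 1 (t + 1), ∑ i ∈ Finset.Icc j t, M.logRatio β (obs ω i)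

/-- The weighted mixture CuSum stopping time with threshold `b` (`⊤` if it never stops). -/
def cusumTime (β : Fin K → ℝ) (b : ℝ) (ω : ObsSeq 𝒳 n) : ℕ∞ :=
  ⨅ (t : ℕ) (_ : 1 ≤ t ∧ (b : EReal) ≤ M.cusumStat β t ω), (t : ℕ∞)

end SensorNetwork

end

/-! The problem reduces to detecting a change between two simple hypotheses, `mixture none` and
`weightedMixture β`, with `β` least favourable.

Upper bound. Permutations of the samples act transitively on the labels of one type and preserve the
mixtures, so the ratio of the `β`-mixture has the same law under every label of a type
(`map_ratio_sampleLaw`). Before the change its mean is at most 1, so the Shiryaev–Roberts statistic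
minus time is a supermartingale. That statistic dominates every likelihood product in the CuSum,
hence is at least `γ` when the CuSum stops, and optional stopping gives mean running length at least
`γ` (`le_lintegral_of_le_shiryaevRoberts`). After the change, minimality of `β` yields the
first-order condition that `log_ratio_mixture` has mean at least `I` under each type
(`integral_llr_le_of_klDiv_minimal`). Truncating the increments at `c` costs at most `δ` in the
mean, and Wald's argument bounds the delay by `(log γ + c) / (I - δ)`, whatever the trajectory and
the past (`exists_wadd_cusumTime_le`).

Lower bound. Drawing types from `β` and labels uniformly, independently over time, turns the
constraints on a feasible `τ` into constraints under the i.i.d. mixtures (`le_wadd_of_feasible`).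
For two simple hypotheses, a change of measure over a window of length `m` after each possible
change compares delay with false alarms; summing over all change-points telescopes, and a mean
running length of at least `γ` gives a linear inequality for the delay (`delay_lower_bound`). With
`m = ⌈(log γ)²⌉` it reads `log γ / I` to first order. -/

noncomputable section

/-! ### Independent sequences: past and present, change of measure, mixing of factors -/

section SequenceSpace

variable {E : Type*} [MeasurableSpace E]

/-- The σ-algebra on `ℕ → E` generated by the coordinates with index less than `t`. -/
@[reducible] def pastAlgebra (E : Type*) [MeasurableSpace E] (t : ℕ) : MeasurableSpace (ℕ → E) :=
  ⨆ s : ℕ, ⨆ _ : s < t, MeasurableSpace.comap (fun ω : ℕ → E => ω s) inferInstance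

lemma pastAlgebra_le (t : ℕ) :
    pastAlgebra E t ≤ (inferInstance : MeasurableSpace (ℕ → E)) :=
  iSup_le fun s => iSup_le fun _ => (measurable_pi_apply s).comap_le

lemma pastAlgebra_mono {s t : ℕ} (h : s ≤ t) : pastAlgebra E s ≤ pastAlgebra E t :=
  iSup_mono fun _ => iSup_mono' fun h' => ⟨lt_of_lt_of_le h' h, le_rfl⟩

lemma measurable_eval_past {s t : ℕ} (h : s < t) :
    Measurable[pastAlgebra E t] (fun ω : ℕ → E => ω s) :=
  Measurable.of_comap_le (le_iSup₂_of_le s h le_rfl)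

variable (μ μ' : ℕ → Measure E) [∀ t, IsProbabilityMeasure (μ t)]
  [∀ t, IsProbabilityMeasure (μ' t)]

lemma indep_past_eval (t : ℕ) :
    Indep (pastAlgebra E t) (MeasurableSpace.comap (fun ω : ℕ → E => ω t) inferInstance)
      (Measure.infinitePi μ) := by
  have h : iIndepFun (fun (i : ℕ) (ω : ℕ → E) => ω i) (Measure.infinitePi μ) :=
    iIndepFun_infinitePi (X := fun _ x => x) (fun _ => measurable_id)
  have h2 := indep_iSup_of_disjoint (S := {s | s < t}) (T := {t})
    (fun i => (measurable_pi_apply i).comap_le) h.iIndep (by simp)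
  simpa [pastAlgebra] using h2

lemma lintegral_past_mul_eval {t : ℕ} {f : (ℕ → E) → ℝ≥0∞} (hf : Measurable[pastAlgebra E t] f)
    {g : E → ℝ≥0∞} (hg : Measurable g) :
    ∫⁻ ω, f ω * g (ω t) ∂(Measure.infinitePi μ)
      = (∫⁻ ω, f ω ∂(Measure.infinitePi μ)) * ∫⁻ x, g x ∂(μ t) := by
  have h := lintegral_mul_eq_lintegral_mul_lintegral_of_independent_measurableSpace
    (g := fun ω : ℕ → E => g (ω t))
    (pastAlgebra_le t) (measurable_pi_apply t).comap_le (indep_past_eval μ t) hf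
    (hg.comp (comap_measurable _))
  rw [h, ← (measurePreserving_eval_infinitePi μ t).lintegral_comp hg]

lemma setIntegral_past_eval {t : ℕ} {A : Set (ℕ → E)} (hA : MeasurableSet[pastAlgebra E t] A)
    {y : E → ℝ} (hy : Measurable y) :
    ∫ ω in A, y (ω t) ∂(Measure.infinitePi μ)
      = (Measure.infinitePi μ).real A * ∫ x, y x ∂(μ t) := by
  rw [(indep_past_eval μ t).setIntegral_eq_mul (pastAlgebra_le t)
    (measurable_pi_apply t).aemeasurable hA hy.aestronglyMeasurable]
  congr 1
  conv_rhs => rw [← Measure.infinitePi_map_eval μ t]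
  rw [integral_map (measurable_pi_apply t).aemeasurable hy.aestronglyMeasurable]

lemma integrable_eval {t : ℕ} {y : E → ℝ} (hy : Integrable y (μ t)) :
    Integrable (fun ω : ℕ → E => y (ω t)) (Measure.infinitePi μ) :=
  (measurePreserving_eval_infinitePi μ t).integrable_comp_of_integrable hy

lemma ae_eval {t : ℕ} {p : E → Prop} (h : ∀ᵐ x ∂(μ t), p x) :
    ∀ᵐ ω ∂(Measure.infinitePi μ), p (ω t) :=
  (measurePreserving_eval_infinitePi μ t).quasiMeasurePreserving.ae h

lemma lintegral_infinitePi_prod (s : Finset ℕ) {φ : ℕ → E → ℝ≥0∞} (hφ : ∀ i, Measurable (φ i)) :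
    ∫⁻ ω, ∏ i ∈ s, φ i (ω i) ∂(Measure.infinitePi μ) = ∏ i ∈ s, ∫⁻ x, φ i x ∂(μ i) := by
  refine (lintegral_prod_eq_prod_lintegral_of_indepFun s (fun i (ω : ℕ → E) => φ i (ω i))
    (iIndepFun_infinitePi hφ) (fun i => (hφ i).comp (measurable_pi_apply i))).trans ?_
  exact Finset.prod_congr rfl fun i _ =>
    (measurePreserving_eval_infinitePi μ i).lintegral_comp (hφ i)

lemma pastAlgebra_le_comap_restrict (t : ℕ) :
    pastAlgebra E t ≤ MeasurableSpace.comap ((Finset.range t).restrict (π := fun _ => E))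
      inferInstance := by
  refine iSup₂_le fun s hs => ?_
  have : (fun ω : ℕ → E => ω s) = (fun x : (Finset.range t → E) => x ⟨s, by simpa using hs⟩) ∘
      (Finset.range t).restrict (π := fun _ => E) := rfl
  rw [this, ← MeasurableSpace.comap_comp]
  exact MeasurableSpace.comap_mono (measurable_pi_apply _).comap_le

-- An event of the past factors through the restriction to finitely many coordinates, and the two
-- restricted product laws coincide.
variable {μ μ'} in
lemma infinitePi_eq_of_past {t : ℕ} (h : ∀ s < t, μ s = μ' s) {A : Set (ℕ → E)}
    (hA : MeasurableSet[pastAlgebra E t] A) :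
    Measure.infinitePi μ A = Measure.infinitePi μ' A := by
  obtain ⟨B, hB, rfl⟩ := pastAlgebra_le_comap_restrict t A hA
  rw [← Measure.map_apply (Finset.measurable_restrict _) hB,
    ← Measure.map_apply (Finset.measurable_restrict _) hB, Measure.infinitePi_map_restrict,
    Measure.infinitePi_map_restrict]
  congr 2
  ext1 i
  exact h _ (Finset.mem_range.1 i.2)

-- Both sides agree on boxes. Only one factor is altered: infinite products that differ in
-- infinitely many factors may be mutually singular.
variable {μ μ'} in
lemma infinitePi_eq_withDensity {j : ℕ} {h : E → ℝ≥0∞} (hh : Measurable h)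
    (hne : ∀ i, i ≠ j → μ' i = μ i) (hj : μ' j = (μ j).withDensity h) :
    Measure.infinitePi μ' = (Measure.infinitePi μ).withDensity (fun ω => h (ω j)) := by
  symm
  refine Measure.eq_infinitePi _ fun s t ht => ?_
  have hone : ∫⁻ x, h x ∂(μ j) = 1 := by
    have := measure_univ (μ := μ' j)
    rwa [hj, withDensity_apply _ .univ, setLIntegral_univ] at this
  have hbox : MeasurableSet (Set.pi (s : Set ℕ) t) := .pi s.countable_toSet fun i _ => ht i
  classical
  let φ : ℕ → E → ℝ≥0∞ := fun i x =>
    (if i ∈ s then (t i).indicator 1 x else 1) * (if i = j then h x else 1)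
  have hφ : ∀ i, Measurable (φ i) := by
    intro i
    refine Measurable.mul ?_ ?_
    · split_ifs
      · exact measurable_one.indicator (ht i)
      · exact measurable_const
    · split_ifs
      · exact hh
      · exact measurable_const
  rw [withDensity_apply _ hbox, ← lintegral_indicator hbox]
  have e1 : ∀ ω : ℕ → E, (Set.pi (s : Set ℕ) t).indicator (fun ω => h (ω j)) ω
      = ∏ i ∈ insert j s, φ i (ω i) := by
    intro ω
    rw [Finset.prod_mul_distrib, Finset.prod_ite_eq' (insert j s) j (fun i => h (ω i))]
    have e2 : ∏ i ∈ insert j s, (if i ∈ s then (t i).indicator (1 : E → ℝ≥0∞) (ω i) else 1)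
        = (Set.pi (s : Set ℕ) t).indicator 1 ω := by
      rw [← Finset.prod_subset (Finset.subset_insert j s) (by intro i _ hi; simp [hi])]
      rw [Finset.prod_congr rfl (g := fun i => (t i).indicator (1 : E → ℝ≥0∞) (ω i))
        (by intro i hi; simp [hi])]
      by_cases hω : ω ∈ Set.pi (s : Set ℕ) t
      · rw [Set.indicator_of_mem hω]
        exact Finset.prod_eq_one fun i hi => Set.indicator_of_mem (hω i hi) _
      · rw [Set.indicator_of_notMem hω]
        simp only [Set.mem_pi, not_forall] at hω
        obtain ⟨i, hi, hi'⟩ := hω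
        exact Finset.prod_eq_zero hi (Set.indicator_of_notMem hi' _)
    rw [e2]
    by_cases hω : ω ∈ Set.pi (s : Set ℕ) t <;> simp [hω]
  rw [lintegral_congr e1, lintegral_infinitePi_prod μ _ hφ]
  have e3 : ∀ i ∈ s, ∫⁻ x, φ i x ∂(μ i) = μ' i (t i) := by
    intro i hi
    by_cases hij : i = j
    · subst hij
      rw [hj, withDensity_apply _ (ht i), ← lintegral_indicator (ht i)]
      refine lintegral_congr fun x => ?_
      by_cases hx : x ∈ t i <;> simp [φ, hi, hx]
    · simp [φ, hi, hij, hne i hij, lintegral_indicator_one (ht i)]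
  by_cases hjs : j ∈ s
  · rw [Finset.insert_eq_of_mem hjs]
    exact Finset.prod_congr rfl e3
  · rw [Finset.prod_insert hjs, Finset.prod_congr rfl e3]
    simp [φ, hjs, hone]

variable {μ μ'} in
lemma lintegral_mul_inv_density_le {j : ℕ} {h : E → ℝ≥0∞} (hh : Measurable h)
    (hne : ∀ i, i ≠ j → μ' i = μ i) (hj : μ' j = (μ j).withDensity h)
    {f : (ℕ → E) → ℝ≥0∞} (hf : Measurable f) :
    ∫⁻ ω, f ω * (h (ω j))⁻¹ ∂(Measure.infinitePi μ') ≤ ∫⁻ ω, f ω ∂(Measure.infinitePi μ) := by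
  have hm : Measurable fun ω : ℕ → E => h (ω j) := hh.comp (measurable_pi_apply j)
  rw [infinitePi_eq_withDensity hh hne hj, lintegral_withDensity_eq_lintegral_mul _ hm
    (g := fun ω => f ω * (h (ω j))⁻¹) (hf.mul hm.inv)]
  refine lintegral_mono fun ω => ?_
  simp only [Pi.mul_apply]
  -- Equality fails only where the density is `0` or `⊤`; the inequality makes absolute continuity
  -- in the other direction unnecessary.
  calc h (ω j) * (f ω * (h (ω j))⁻¹) = f ω * (h (ω j) * (h (ω j))⁻¹) := by ring
    _ ≤ f ω * 1 := by gcongr; exact ENNReal.mul_inv_le_one _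
    _ = f ω := mul_one _

lemma measurable_infinitePi {Λ : Type*} [MeasurableSpace Λ] {κ : ℕ → Λ → Measure E}
    [∀ t a, IsProbabilityMeasure (κ t a)] (hκ : ∀ t, Measurable (κ t)) :
    Measurable fun a : ℕ → Λ => Measure.infinitePi fun t => κ t (a t) := by
  refine Measurable.measure_of_isPiSystem_of_isProbabilityMeasure
    (S := squareCylinders fun _ : ℕ => {s : Set E | MeasurableSet s})
    generateFrom_squareCylinders.symm
    (isPiSystem_squareCylinders (fun _ => MeasurableSpace.isPiSystem_measurableSet)
      fun _ => MeasurableSet.univ) ?_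
  rintro _ ⟨s, t, ht, rfl⟩
  have ht' : ∀ i, MeasurableSet (t i) := fun i => ht i trivial
  simp_rw [Measure.infinitePi_pi _ fun i (_ : i ∈ s) => ht' i]
  exact Finset.measurable_prod _ fun i _ =>
    (Measure.measurable_coe (ht' i)).comp ((hκ i).comp (measurable_pi_apply i))

/-- Mixing the factors of a product measure independently amounts to mixing the product measures
over a product of the mixing laws. -/
lemma infinitePi_bind {Λ : Type*} [MeasurableSpace Λ] {κ : ℕ → Λ → Measure E}
    [∀ t a, IsProbabilityMeasure (κ t a)] (hκ : ∀ t, Measurable (κ t))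
    (w : ℕ → Measure Λ) [∀ t, IsProbabilityMeasure (w t)]
    (hμ : ∀ t, μ t = (w t).bind (κ t)) :
    (Measure.infinitePi w).bind (fun a => Measure.infinitePi fun t => κ t (a t))
      = Measure.infinitePi μ := by
  refine Measure.eq_infinitePi _ fun s t ht => ?_
  rw [Measure.bind_apply (.pi s.countable_toSet fun i _ => ht i)
    (measurable_infinitePi hκ).aemeasurable]
  simp_rw [Measure.infinitePi_pi _ fun i (_ : i ∈ s) => ht i]
  rw [lintegral_infinitePi_prod w s (φ := fun i a => κ i a (t i))
    fun i => (Measure.measurable_coe (ht i)).comp (hκ i)]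
  refine Finset.prod_congr rfl fun i _ => ?_
  rw [hμ, Measure.bind_apply (ht i) (hκ i).aemeasurable]

end SequenceSpace

lemma ENat.tsum_lt_eq (x : ℕ∞) :
    ∑' i : ℕ, (if (i : ℕ∞) < x then 1 else 0 : ℝ≥0∞) = (x : ℝ≥0∞) := by
  induction x using ENat.recTopCoe with
  | top => simp
  | coe n =>
    rw [tsum_eq_sum (s := Finset.range n) (by intro i hi; simpa using hi),
      Finset.sum_congr rfl (g := fun _ => 1) (by intro i hi; simpa using hi)]
    simp

/-! ### First-order condition for a minimizer of the Kullback–Leibler divergence -/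

section Divergence

variable {α : Type*} [MeasurableSpace α] {μ ν ρ : Measure α} [IsProbabilityMeasure μ]
  [IsProbabilityMeasure ν] [IsProbabilityMeasure ρ]

lemma integrable_div_rnDeriv (hμ : μ ≪ ν) {h : α → ℝ} (hm : Measurable h) (hi : Integrable h ν) :
    Integrable (fun x => h x / (μ.rnDeriv ν x).toReal) μ := by
  rw [← integrable_toReal_rnDeriv_mul_iff hμ]
  refine hi.mono (by fun_prop) (ae_of_all _ fun x => ?_)
  by_cases hx : (μ.rnDeriv ν x).toReal = 0
  · simp [hx]
  · rw [mul_div_cancel₀ _ hx]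

/-- Multiplying by the density undoes the division except where the density vanishes, where the
quotient is `0` by convention; this loses a nonnegative part of `h`. -/
lemma integral_div_rnDeriv_le (hμ : μ ≪ ν) {h : α → ℝ} (hm : Measurable h) (hi : Integrable h ν)
    (hpos : ∀ x, 0 ≤ h x) :
    ∫ x, h x / (μ.rnDeriv ν x).toReal ∂μ ≤ ∫ x, h x ∂ν := by
  rw [← integral_toReal_rnDeriv_mul hμ]
  refine integral_mono_ae ((integrable_toReal_rnDeriv_mul_iff hμ).2
    (integrable_div_rnDeriv hμ hm hi)) hi (ae_of_all _ fun x => ?_)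
  by_cases hx : (μ.rnDeriv ν x).toReal = 0
  · simp [hx, hpos x]
  · simp only [mul_div_cancel₀ _ hx, le_refl]

lemma ae_rnDeriv_toReal_pos (hμ : μ ≪ ν) : ∀ᵐ x ∂μ, 0 < (μ.rnDeriv ν x).toReal := by
  filter_upwards [Measure.rnDeriv_pos hμ, hμ.ae_le (Measure.rnDeriv_ne_top μ ν)] with x h1 h2
  exact ENNReal.toReal_pos h1.ne' h2

/-- A logarithm of a density that is comparable with the density of `μ` is `μ`-integrable. -/
lemma integrable_log_of_le (hμ : μ ≪ ν) (hint : Integrable (llr μ ν) μ) {u h : α → ℝ}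
    (hum : Measurable u) (hm : Measurable h) (hi : Integrable h ν) {c : ℝ} (hc : 0 < c)
    (hlow : ∀ x, c * (μ.rnDeriv ν x).toReal ≤ u x)
    (hup : ∀ x, u x ≤ (μ.rnDeriv ν x).toReal + h x) :
    Integrable (fun x => Real.log (u x)) μ := by
  refine integrable_of_le_of_le (f := fun x => Real.log (u x))
    (g₁ := fun x => Real.log c + llr μ ν x)
    (g₂ := fun x => llr μ ν x + h x / (μ.rnDeriv ν x).toReal)
    (Real.measurable_log.comp hum).aestronglyMeasurable ?_ ?_
    ((integrable_const _).add hint) (hint.add (integrable_div_rnDeriv hμ hm hi))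
  · filter_upwards [ae_rnDeriv_toReal_pos hμ] with x hx
    rw [llr_def, ← Real.log_mul hc.ne' hx.ne']
    exact Real.log_le_log (by positivity) (hlow x)
  · filter_upwards [ae_rnDeriv_toReal_pos hμ] with x hx
    have h0 : 0 < u x := lt_of_lt_of_le (by positivity) (hlow x)
    -- With `f` the density of `μ`: `log (u / f) ≤ u / f - 1 ≤ h / f`, and `h / f` is
    -- `μ`-integrable.
    have h1 : Real.log (u x / (μ.rnDeriv ν x).toReal) ≤ u x / (μ.rnDeriv ν x).toReal - 1 :=
      Real.log_le_sub_one_of_pos (by positivity)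
    rw [Real.log_div h0.ne' hx.ne'] at h1
    have h2 : u x / (μ.rnDeriv ν x).toReal ≤ 1 + h x / (μ.rnDeriv ν x).toReal := by
      rw [div_le_iff₀ hx, add_mul, div_mul_cancel₀ _ hx.ne']; linarith [hup x]
    rw [llr_def]; simp only; linarith

/-- The `ε`-step from `μ` towards `ρ`. -/
def convexStep (μ ρ : Measure α) (ε : ℝ) : Measure α :=
  ENNReal.ofReal (1 - ε) • μ + ENNReal.ofReal ε • ρ

lemma isProbabilityMeasure_convexStep {ε : ℝ} (h0 : 0 < ε) (h1 : ε < 1) :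
    IsProbabilityMeasure (convexStep μ ρ ε) := by
  constructor
  simp only [convexStep, Measure.coe_add, Measure.coe_smul, Pi.add_apply, Pi.smul_apply,
    measure_univ, smul_eq_mul, mul_one]
  rw [← ENNReal.ofReal_add (by linarith) h0.le]; simp

lemma llr_convexStep {ε : ℝ} (h0 : 0 < ε) (h1 : ε < 1) :
    llr (convexStep μ ρ ε) ν =ᵐ[ν] fun x =>
      Real.log ((1 - ε) * (μ.rnDeriv ν x).toReal + ε * (ρ.rnDeriv ν x).toReal) := by
  have : IsFiniteMeasure (ENNReal.ofReal (1 - ε) • μ) := μ.smul_finite ENNReal.ofReal_ne_top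
  have : IsFiniteMeasure (ENNReal.ofReal ε • ρ) := ρ.smul_finite ENNReal.ofReal_ne_top
  have e1 := Measure.rnDeriv_add' (ENNReal.ofReal (1 - ε) • μ) (ENNReal.ofReal ε • ρ) ν
  have e2 := Measure.rnDeriv_smul_left_of_ne_top' μ ν (r := ENNReal.ofReal (1 - ε))
    ENNReal.ofReal_ne_top
  have e3 := Measure.rnDeriv_smul_left_of_ne_top' ρ ν (r := ENNReal.ofReal ε)
    ENNReal.ofReal_ne_top
  filter_upwards [e1, e2, e3, Measure.rnDeriv_ne_top μ ν, Measure.rnDeriv_ne_top ρ ν]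
    with x h1x h2x h3x h4x h5x
  simp only [llr_def, convexStep]
  rw [h1x, Pi.add_apply, h2x, h3x]
  simp only [Pi.smul_apply, smul_eq_mul]
  rw [ENNReal.toReal_add (ENNReal.mul_ne_top ENNReal.ofReal_ne_top h4x)
    (ENNReal.mul_ne_top ENNReal.ofReal_ne_top h5x), ENNReal.toReal_mul, ENNReal.toReal_mul,
    ENNReal.toReal_ofReal (by linarith), ENNReal.toReal_ofReal h0.le]

/-- If `μ` does not lose divergence by a small step towards `ρ`, then the divergence of `μ` bounds
from below the `ρ`-expectation of the log-likelihood of that step. -/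
lemma klDiv_le_integral_log_convexStep (hμ : μ ≪ ν) (hρ : ρ ≪ ν)
    (hμi : Integrable (llr μ ν) μ) (hρi : Integrable (llr ρ ν) ρ) {ε : ℝ} (h0 : 0 < ε) (h1 : ε < 1)
    (hmin : InformationTheory.klDiv μ ν ≤ InformationTheory.klDiv (convexStep μ ρ ε) ν) :
    Integrable (fun x => Real.log
      ((1 - ε) * (μ.rnDeriv ν x).toReal + ε * (ρ.rnDeriv ν x).toReal)) ρ ∧
    ∫ x, llr μ ν x ∂μ ≤ ∫ x, Real.log
      ((1 - ε) * (μ.rnDeriv ν x).toReal + ε * (ρ.rnDeriv ν x).toReal) ∂ρ := by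
  set f : α → ℝ := fun x => (μ.rnDeriv ν x).toReal with hf
  set g : α → ℝ := fun x => (ρ.rnDeriv ν x).toReal with hg
  set u : α → ℝ := fun x => (1 - ε) * f x + ε * g x with hu
  have hfm : Measurable f := (Measure.measurable_rnDeriv _ _).ennreal_toReal
  have hgm : Measurable g := (Measure.measurable_rnDeriv _ _).ennreal_toReal
  have hum : Measurable u := (hfm.const_mul _).add (hgm.const_mul _)
  have hf0 : ∀ x, 0 ≤ f x := fun x => ENNReal.toReal_nonneg
  have hg0 : ∀ x, 0 ≤ g x := fun x => ENNReal.toReal_nonneg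
  have hfi : Integrable f ν := Measure.integrable_toReal_rnDeriv
  have hgi : Integrable g ν := Measure.integrable_toReal_rnDeriv
  have hui : Integrable u ν := (hfi.const_mul _).add (hgi.const_mul _)
  have iμ : Integrable (fun x => Real.log (u x)) μ :=
    integrable_log_of_le hμ hμi hum hgm hgi (c := 1 - ε) (by linarith)
      (fun x => by simp only [hu]; nlinarith [hg0 x])
      (fun x => by simp only [hu]; nlinarith [hg0 x, hf0 x])
  have iρ : Integrable (fun x => Real.log (u x)) ρ :=
    integrable_log_of_le hρ hρi hum hfm hfi (c := ε) h0
      (fun x => by simp only [hu]; nlinarith [hf0 x])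
      (fun x => by simp only [hu]; nlinarith [hg0 x, hf0 x])
  refine ⟨iρ, ?_⟩
  have hac : convexStep μ ρ ε ≪ ν :=
    Measure.AbsolutelyContinuous.add_left (hμ.smul_left _) (hρ.smul_left _)
  have hllr := hac.ae_le (llr_convexStep (μ := μ) (ρ := ρ) (ν := ν) h0 h1)
  have := isProbabilityMeasure_convexStep (μ := μ) (ρ := ρ) h0 h1
  have istep : Integrable (fun x => Real.log (u x)) (convexStep μ ρ ε) :=
    (iμ.smul_measure ENNReal.ofReal_ne_top).add_measure (iρ.smul_measure ENNReal.ofReal_ne_top)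
  have e1 : (InformationTheory.klDiv (convexStep μ ρ ε) ν).toReal
      = (1 - ε) * ∫ x, Real.log (u x) ∂μ + ε * ∫ x, Real.log (u x) ∂ρ := by
    rw [InformationTheory.toReal_klDiv_of_measure_eq hac (by simp), integral_congr_ae hllr,
      convexStep, integral_add_measure (iμ.smul_measure ENNReal.ofReal_ne_top)
      (iρ.smul_measure ENNReal.ofReal_ne_top), integral_smul_measure, integral_smul_measure,
      ENNReal.toReal_ofReal (by linarith), ENNReal.toReal_ofReal h0.le]
    rfl
  have e2 : (InformationTheory.klDiv μ ν).toReal = ∫ x, llr μ ν x ∂μ :=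
    InformationTheory.toReal_klDiv_of_measure_eq hμ (by simp)
  have hne : InformationTheory.klDiv (convexStep μ ρ ε) ν ≠ ⊤ :=
    InformationTheory.klDiv_ne_top hac ((integrable_congr hllr).2 istep)
  have e3 := ENNReal.toReal_mono hne hmin
  -- Gibbs' inequality: `log t ≤ t - 1` at `t = u / f`, and `u / f` has `μ`-mean at most `∫ u dν =
  -- 1`. The divergence of the step is `(1 - ε) ∫ log u dμ + ε ∫ log u dρ`, so replacing the first
  -- integral by that of `llr μ ν` and dividing by `ε` gives the claim.
  have gibbs : ∫ x, Real.log (u x) ∂μ ≤ ∫ x, llr μ ν x ∂μ := by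
    have b1 : ∫ x, Real.log (u x) ∂μ ≤ ∫ x, (llr μ ν x + u x / f x - 1) ∂μ := by
      refine integral_mono_ae iμ ((hμi.add (integrable_div_rnDeriv hμ hum hui)).sub
        (integrable_const _)) ?_
      filter_upwards [ae_rnDeriv_toReal_pos hμ] with x hx
      have hux : 0 < u x := by
        have : 0 < (1 - ε) * f x := mul_pos (by linarith) hx
        simp only [hu]; nlinarith [hg0 x]
      have := Real.log_le_sub_one_of_pos (x := u x / f x) (div_pos hux hx)
      rw [Real.log_div hux.ne' hx.ne'] at this
      rw [llr_def]; simp only [hf] at this ⊢; linarith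
    have b2 : ∫ x, u x / f x ∂μ ≤ 1 := by
      refine (integral_div_rnDeriv_le hμ hum hui ?_).trans ?_
      · intro x; simp only [hu]; nlinarith [hf0 x, hg0 x]
      · simp only [hu]
        rw [integral_add (hfi.const_mul _) (hgi.const_mul _), integral_const_mul,
          integral_const_mul, Measure.integral_toReal_rnDeriv hμ,
          Measure.integral_toReal_rnDeriv hρ]
        simp
    have hdi : Integrable (fun x => u x / f x) μ := integrable_div_rnDeriv hμ hum hui
    have b3 : ∫ x, (llr μ ν x + u x / f x - 1) ∂μ
        = ∫ x, llr μ ν x ∂μ + ∫ x, u x / f x ∂μ - 1 := by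
      have s1 := integral_sub (hμi.add hdi) (integrable_const (1 : ℝ))
      have s2 := integral_add hμi hdi
      simp only [Pi.add_apply, integral_const, probReal_univ, smul_eq_mul, mul_one] at s1
      rw [s1, s2]
    linarith
  rw [e1, e2] at e3
  nlinarith

/-- First-order condition: if `μ` minimizes the divergence on the segment towards `ρ`, then the
log-likelihood ratio of `μ` has at least the same expectation under `ρ` as under `μ`. -/
theorem integral_llr_le_of_klDiv_minimal (hμ : μ ≪ ν) (hρ : ρ ≪ ν)
    (hμi : Integrable (llr μ ν) μ) (hρi : Integrable (llr ρ ν) ρ)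
    (hmin : ∀ ε : ℝ, 0 < ε → ε < 1 →
      InformationTheory.klDiv μ ν ≤ InformationTheory.klDiv (convexStep μ ρ ε) ν) :
    (∀ᵐ x ∂ρ, 0 < (μ.rnDeriv ν x).toReal) ∧ Integrable (llr μ ν) ρ ∧
      ∫ x, llr μ ν x ∂μ ≤ ∫ x, llr μ ν x ∂ρ := by
  set f : α → ℝ := fun x => (μ.rnDeriv ν x).toReal with hf
  set g : α → ℝ := fun x => (ρ.rnDeriv ν x).toReal with hg
  have hfm : Measurable f := (Measure.measurable_rnDeriv _ _).ennreal_toReal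
  have hgm : Measurable g := (Measure.measurable_rnDeriv _ _).ennreal_toReal
  have hf0 : ∀ x, 0 ≤ f x := fun x => ENNReal.toReal_nonneg
  have hg0 : ∀ x, 0 ≤ g x := fun x => ENNReal.toReal_nonneg
  have hfi : Integrable f ν := Measure.integrable_toReal_rnDeriv
  have isum : ∀ c : ℝ, 0 < c → c ≤ 1 → Integrable (fun x => Real.log (f x + c * g x)) ρ := by
    intro c hc hc1
    exact integrable_log_of_le hρ hρi (hfm.add (hgm.const_mul _)) hfm hfi hc
      (fun x => by nlinarith [hf0 x]) (fun x => by nlinarith [hg0 x])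
  have iC : Integrable (fun x => Real.log (f x + g x)) ρ := by
    simpa using isum 1 one_pos le_rfl
  set I : ℝ := ∫ x, llr μ ν x ∂μ with hI
  set C : ℝ := ∫ x, Real.log (f x + g x) ∂ρ with hC
  have hgpos : ∀ᵐ x ∂ρ, 0 < g x := ae_rnDeriv_toReal_pos hρ
  let δ : ℕ → ℝ := fun j => 1 / ((j : ℝ) + 2)
  have hδ0 : ∀ j, 0 < δ j := fun j => by positivity
  have hδ1 : ∀ j, δ j < 1 := fun j => by
    simp only [δ]; rw [div_lt_one (by positivity)]; linarith [(Nat.cast_nonneg j : (0 : ℝ) ≤ j)]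
  have hδt : Tendsto δ atTop (𝓝 0) := by
    have : Tendsto (fun j : ℕ => (j : ℝ) + 2) atTop atTop :=
      tendsto_atTop_add_const_right _ _ tendsto_natCast_atTop_atTop
    simp only [δ, one_div]
    exact this.inv_tendsto_atTop
  -- Fatou's lemma replaces differentiation at `ε = 0`. Subtracting from the integrable `log (f +
  -- g)` makes the integrands nonnegative, with integrals at most `C - I` for every step size `δ j`.
  let d : ℕ → α → ℝ≥0∞ := fun j x =>
    ENNReal.ofReal (Real.log (f x + g x) - Real.log (f x + δ j * g x))
  have hdm : ∀ j, Measurable (d j) := fun j =>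
    ((Real.measurable_log.comp (hfm.add hgm)).sub
      (Real.measurable_log.comp (hfm.add (hgm.const_mul _)))).ennreal_ofReal
  have hbound : ∀ j, I ≤ C ∧ ∫⁻ x, d j x ∂ρ ≤ ENNReal.ofReal (C - I) := by
    intro j
    obtain ⟨i1, i2⟩ := klDiv_le_integral_log_convexStep hμ hρ hμi hρi (hδ0 j) (hδ1 j)
      (hmin _ (hδ0 j) (hδ1 j))
    have i3 : I ≤ ∫ x, Real.log (f x + δ j * g x) ∂ρ := by
      refine i2.trans (integral_mono_ae i1 (isum _ (hδ0 j) (hδ1 j).le) ?_)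
      filter_upwards [hgpos] with x hx
      have h1 : 0 < δ j * g x := mul_pos (hδ0 j) hx
      have h2 : 0 ≤ (1 - δ j) * f x := mul_nonneg (by linarith [hδ1 j]) (hf0 x)
      refine Real.log_le_log (by simp only [hf, hg] at *; linarith) ?_
      simp only [hf, hg] at *
      nlinarith [hδ0 j, hf0 x]
    have hnn : ∀ᵐ x ∂ρ, 0 ≤ Real.log (f x + g x) - Real.log (f x + δ j * g x) := by
      filter_upwards [hgpos] with x hx
      have h1 : 0 < δ j * g x := mul_pos (hδ0 j) hx
      have := Real.log_le_log (x := f x + δ j * g x) (y := f x + g x) (by linarith [hf0 x])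
        (by nlinarith [hδ1 j])
      linarith
    have hi := iC.sub (isum _ (hδ0 j) (hδ1 j).le)
    have heq := ofReal_integral_eq_lintegral_ofReal hi hnn
    have hsub := integral_sub iC (isum _ (hδ0 j) (hδ1 j).le)
    have hge := integral_nonneg_of_ae hnn
    refine ⟨by linarith, ?_⟩
    simp only [d]
    simp only [Pi.sub_apply] at heq
    rw [← heq]
    exact ENNReal.ofReal_le_ofReal (by linarith)
  have hfatou : ∫⁻ x, liminf (fun j => d j x) atTop ∂ρ ≤ ENNReal.ofReal (C - I) :=
    (lintegral_liminf_le hdm).trans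
      (liminf_le_of_frequently_le' (Frequently.of_forall fun j => (hbound j).2))
  -- A zero of `f` makes the limit infinite, which the bound allows only on a `ρ`-null set. This
  -- positivity has to be proved separately because `Real.log 0 = 0` hides such points.
  have hlim_top : ∀ x, 0 < g x → f x = 0 → liminf (fun j => d j x) atTop = ⊤ := by
    intro x hgx hfx
    refine Tendsto.liminf_eq (ENNReal.tendsto_ofReal_nhds_top.2 ?_)
    have : ∀ j, Real.log (f x + g x) - Real.log (f x + δ j * g x) = - Real.log (δ j) := by
      intro j
      rw [hfx, zero_add, zero_add, Real.log_mul (hδ0 j).ne' hgx.ne']; ring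
    simp_rw [this]
    exact tendsto_neg_atBot_atTop.comp (Real.tendsto_log_nhdsGT_zero.comp
      (tendsto_nhdsWithin_iff.2 ⟨hδt, Eventually.of_forall fun j => hδ0 j⟩))
  have hfpos : ∀ᵐ x ∂ρ, 0 < f x := by
    filter_upwards [hgpos, ae_lt_top (Measurable.liminf hdm)
      (hfatou.trans_lt ENNReal.ofReal_lt_top).ne] with x hgx hlt
    by_contra hcon
    exact hlt.ne (hlim_top x hgx (le_antisymm (not_lt.1 hcon) (hf0 x)))
  have hlim : ∀ᵐ x ∂ρ, liminf (fun j => d j x) atTop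
      = ENNReal.ofReal (Real.log (f x + g x) - Real.log (f x)) := by
    filter_upwards [hfpos] with x hx
    refine Tendsto.liminf_eq (ENNReal.tendsto_ofReal (tendsto_const_nhds.sub ?_))
    have : Tendsto (fun j => f x + δ j * g x) atTop (𝓝 (f x)) := by
      simpa using tendsto_const_nhds.add (hδt.mul_const (g x))
    exact this.log hx.ne'
  rw [lintegral_congr_ae hlim] at hfatou
  have hnn : ∀ᵐ x ∂ρ, 0 ≤ Real.log (f x + g x) - Real.log (f x) := by
    filter_upwards [hfpos] with x hx
    have := Real.log_le_log hx (le_add_of_nonneg_right (hg0 x) : f x ≤ f x + g x)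
    linarith
  have hdm' : Measurable fun x => Real.log (f x + g x) - Real.log (f x) :=
    (Real.measurable_log.comp (hfm.add hgm)).sub (Real.measurable_log.comp hfm)
  have hint : Integrable (fun x => Real.log (f x + g x) - Real.log (f x)) ρ :=
    ⟨hdm'.aestronglyMeasurable, by
      rw [hasFiniteIntegral_iff_ofReal hnn]; exact hfatou.trans_lt ENNReal.ofReal_lt_top⟩
  have hllr : Integrable (llr μ ν) ρ := by
    refine (iC.sub hint).congr (ae_of_all _ fun x => ?_)
    simp [llr_def, hf]
  refine ⟨hfpos, hllr, ?_⟩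
  have hCI : 0 ≤ C - I := by linarith [(hbound 0).1]
  rw [← ofReal_integral_eq_lintegral_ofReal hint hnn, ENNReal.ofReal_le_ofReal_iff hCI] at hfatou
  have hsub : ∫ x, (Real.log (f x + g x) - Real.log (f x)) ∂ρ = C - ∫ x, llr μ ν x ∂ρ :=
    integral_sub iC hllr
  linarith

end Divergence

/-! ### Mean time to false alarm through the Shiryaev–Roberts statistic -/

section RunningLength

variable {E : Type*} [MeasurableSpace E] (μ : ℕ → Measure E) [∀ t, IsProbabilityMeasure (μ t)]

/-- The Shiryaev–Roberts statistic of the likelihood ratio `L`. -/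
def shiryaevRoberts (L : E → ℝ≥0∞) : ℕ → (ℕ → E) → ℝ≥0∞
  | 0, _ => 0
  | t + 1, ω => (1 + shiryaevRoberts L t ω) * L (ω t)

lemma measurable_shiryaevRoberts {L : E → ℝ≥0∞} (hL : Measurable L) (t : ℕ) :
    Measurable[pastAlgebra E t] (shiryaevRoberts L t) := by
  induction t with
  | zero => exact measurable_const
  | succ t ih =>
    exact (measurable_const.add (ih.mono (pastAlgebra_mono t.le_succ) le_rfl)).mul
      (hL.comp (measurable_eval_past t.lt_succ_self))

-- Unrolled, the recursion is the sum of these products over all starting indices `j < t`.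
omit [MeasurableSpace E] in
lemma prod_le_shiryaevRoberts (L : E → ℝ≥0∞) (ω : ℕ → E) {j t : ℕ} (h : j < t) :
    ∏ i ∈ Finset.Ico j t, L (ω i) ≤ shiryaevRoberts L t ω := by
  induction t with
  | zero => omega
  | succ t ih =>
    rw [Finset.prod_Ico_succ_top (by omega), shiryaevRoberts]
    gcongr
    rcases Nat.lt_succ_iff_lt_or_eq.1 h with h' | rfl
    · exact (ih h').trans le_add_self
    · simp

variable {τ : (ℕ → E) → ℕ∞}

lemma measurableSet_lt_of_stopping
    (hτ : ∀ t : ℕ, MeasurableSet[pastAlgebra E t] {ω | τ ω ≤ t}) (t : ℕ) :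
    MeasurableSet[pastAlgebra E t] {ω | (t : ℕ∞) < τ ω} := by
  have : {ω | (t : ℕ∞) < τ ω} = {ω | τ ω ≤ t}ᶜ := by ext; simp
  rw [this]; exact (hτ t).compl

lemma measurableSet_eq_of_stopping
    (hτ : ∀ t : ℕ, MeasurableSet[pastAlgebra E t] {ω | τ ω ≤ t}) (t : ℕ) :
    MeasurableSet[pastAlgebra E (t + 1)] {ω | τ ω = (t + 1 : ℕ)} := by
  have : {ω | τ ω = (t + 1 : ℕ)} = {ω | τ ω ≤ (t + 1 : ℕ)} ∩ {ω | (t : ℕ∞) < τ ω} := by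
    ext ω
    simp only [Set.mem_ofPred_eq, Set.mem_inter_iff]
    constructor
    · rintro h; rw [h]; exact ⟨le_rfl, by exact_mod_cast t.lt_succ_self⟩
    · rintro ⟨h1, h2⟩
      refine le_antisymm h1 ?_
      push_cast
      exact Order.add_one_le_of_lt h2
  rw [this]
  exact (hτ _).inter (pastAlgebra_mono t.le_succ _ (measurableSet_lt_of_stopping hτ t))

omit [MeasurableSpace E] in
lemma delay_eq_tsum_indicator (v : ℕ) (ω : ℕ → E) : ((τ ω - (v : ℕ∞) : ℕ∞) : ℝ≥0∞)
    = ∑' m : ℕ, Set.indicator {ω | ((v + m : ℕ) : ℕ∞) < τ ω} (1 : (ℕ → E) → ℝ≥0∞) ω := by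
  rw [← ENat.tsum_lt_eq]
  refine tsum_congr fun m => ?_
  simp [Set.indicator_apply, lt_tsub_iff_left]

lemma setLIntegral_delay_eq_tsum
    (hτ : ∀ t : ℕ, MeasurableSet[pastAlgebra E t] {ω | τ ω ≤ t}) (P : Measure (ℕ → E))
    (A : Set (ℕ → E)) (v : ℕ) :
    ∫⁻ ω in A, ((τ ω - (v : ℕ∞) : ℕ∞) : ℝ≥0∞) ∂P
      = ∑' m : ℕ, P (A ∩ {ω | ((v + m : ℕ) : ℕ∞) < τ ω}) := by
  have hm : ∀ t : ℕ, MeasurableSet {ω | (t : ℕ∞) < τ ω} := fun t =>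
    pastAlgebra_le t _ (measurableSet_lt_of_stopping hτ t)
  simp_rw [delay_eq_tsum_indicator]
  rw [lintegral_tsum fun m => (measurable_one.indicator (hm _)).aemeasurable]
  refine tsum_congr fun m => ?_
  rw [lintegral_indicator_one (hm _), Measure.restrict_apply (hm _), Set.inter_comm]

lemma lintegral_eq_tsum_lt
    (hτ : ∀ t : ℕ, MeasurableSet[pastAlgebra E t] {ω | τ ω ≤ t}) (P : Measure (ℕ → E)) :
    ∫⁻ ω, (τ ω : ℝ≥0∞) ∂P = ∑' m : ℕ, P {ω | (m : ℕ∞) < τ ω} := by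
  simpa using setLIntegral_delay_eq_tsum hτ P Set.univ 0

/-- If a stopping time stops only when the Shiryaev–Roberts statistic has reached `g`, then its
mean is at least `g`. -/
theorem le_lintegral_of_le_shiryaevRoberts {L : E → ℝ≥0∞} (hL : Measurable L)
    (hL1 : ∀ t, ∫⁻ x, L x ∂(μ t) ≤ 1)
    (hτ : ∀ t : ℕ, MeasurableSet[pastAlgebra E t] {ω | τ ω ≤ t}) (h1 : ∀ ω, 1 ≤ τ ω) {g : ℝ≥0∞}
    (hreach : ∀ ω (t : ℕ), τ ω = t → g ≤ shiryaevRoberts L t ω) :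
    g ≤ ∫⁻ ω, (τ ω : ℝ≥0∞) ∂(Measure.infinitePi μ) := by
  set P := Measure.infinitePi μ
  have hlt := measurableSet_lt_of_stopping hτ
  have hR := measurable_shiryaevRoberts hL
  -- Optional stopping at `min τ N` for the supermartingale "statistic minus time": `g` replaces the
  -- statistic where `τ` has stopped, and the right side is the mean of `min τ N`.
  have key : ∀ N : ℕ, ∫⁻ ω in {ω | (N : ℕ∞) < τ ω}, shiryaevRoberts L N ω ∂P
      + g * P {ω | τ ω ≤ N} ≤ ∑ t ∈ Finset.range N, P {ω | (t : ℕ∞) < τ ω} := by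
    intro N
    induction N with
    | zero =>
      have : {ω | τ ω ≤ (0 : ℕ)} = ∅ := by
        ext ω
        simp only [Nat.cast_zero, Set.mem_ofPred_eq, Set.mem_empty_iff_false, iff_false, not_le]
        exact lt_of_lt_of_le (by simp) (h1 ω)
      rw [this]; simp [shiryaevRoberts]
    | succ N ih =>
      have hsplit : {ω | τ ω ≤ (N + 1 : ℕ)} = {ω | τ ω ≤ N} ∪ {ω | τ ω = (N + 1 : ℕ)} := by
        ext ω
        simp only [Set.mem_ofPred_eq, Set.mem_union]
        induction τ ω using ENat.recTopCoe with
        | top => simpa using (ENat.natCast_ne_top (N + 1)).symm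
        | coe n => norm_cast; omega
      have hlsplit : {ω | (N : ℕ∞) < τ ω}
          = {ω | ((N + 1 : ℕ) : ℕ∞) < τ ω} ∪ {ω | τ ω = (N + 1 : ℕ)} := by
        ext ω
        simp only [Set.mem_ofPred_eq, Set.mem_union]
        induction τ ω using ENat.recTopCoe with
        | top => simp
        | coe n => norm_cast; omega
      have hdisj : Disjoint {ω | ((N + 1 : ℕ) : ℕ∞) < τ ω} {ω | τ ω = (N + 1 : ℕ)} := by
        rw [Set.disjoint_left]; intro ω ha hb
        simp only [Set.mem_ofPred_eq] at ha hb
        rw [hb] at ha; exact lt_irrefl _ ha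
      have heq := pastAlgebra_le _ _ (measurableSet_eq_of_stopping hτ N)
      -- The event `N < τ` belongs to the past of index `N`, so the new factor `L (ω N)` is
      -- independent of it and contributes its mean, at most 1.
      have hmain : ∫⁻ ω in {ω | (N : ℕ∞) < τ ω}, shiryaevRoberts L (N + 1) ω ∂P
          ≤ P {ω | (N : ℕ∞) < τ ω}
            + ∫⁻ ω in {ω | (N : ℕ∞) < τ ω}, shiryaevRoberts L N ω ∂P := by
        have hA := pastAlgebra_le _ _ (hlt N)
        have hRm : Measurable (shiryaevRoberts L N) := (hR N).mono (pastAlgebra_le _) le_rfl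
        have e1 : ∀ ω, ({ω | (N : ℕ∞) < τ ω}.indicator (shiryaevRoberts L (N + 1))) ω
            = ({ω | (N : ℕ∞) < τ ω}.indicator (fun ω => 1 + shiryaevRoberts L N ω)) ω
              * L (ω N) := by
          intro ω
          by_cases hω : ω ∈ {ω | (N : ℕ∞) < τ ω}
          · rw [Set.indicator_of_mem hω, Set.indicator_of_mem hω, shiryaevRoberts]
          · rw [Set.indicator_of_notMem hω, Set.indicator_of_notMem hω, zero_mul]
        have hFm : Measurable[pastAlgebra E N]
            ({ω | (N : ℕ∞) < τ ω}.indicator (fun ω => 1 + shiryaevRoberts L N ω)) :=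
          (measurable_const.add (hR N)).indicator (hlt N)
        rw [← lintegral_indicator hA, lintegral_congr e1, lintegral_past_mul_eval μ hFm hL,
          lintegral_indicator hA, lintegral_add_left measurable_const, setLIntegral_one]
        calc _ ≤ (P {ω | (N : ℕ∞) < τ ω}
            + ∫⁻ ω in {ω | (N : ℕ∞) < τ ω}, shiryaevRoberts L N ω ∂P) * 1 := by
              gcongr; exact hL1 N
          _ = _ := mul_one _
      have hge : ∫⁻ ω in {ω | ((N + 1 : ℕ) : ℕ∞) < τ ω}, shiryaevRoberts L (N + 1) ω ∂P
          + g * P {ω | τ ω = (N + 1 : ℕ)}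
          ≤ ∫⁻ ω in {ω | (N : ℕ∞) < τ ω}, shiryaevRoberts L (N + 1) ω ∂P := by
        rw [hlsplit, lintegral_union heq hdisj]
        gcongr
        rw [← setLIntegral_const]
        exact setLIntegral_mono' heq fun ω hω => hreach ω _ hω
      calc _ ≤ ∫⁻ ω in {ω | ((N + 1 : ℕ) : ℕ∞) < τ ω}, shiryaevRoberts L (N + 1) ω ∂P
          + g * (P {ω | τ ω ≤ N} + P {ω | τ ω = (N + 1 : ℕ)}) := by
            rw [hsplit]; gcongr; exact measure_union_le _ _
        _ = (∫⁻ ω in {ω | ((N + 1 : ℕ) : ℕ∞) < τ ω}, shiryaevRoberts L (N + 1) ω ∂P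
          + g * P {ω | τ ω = (N + 1 : ℕ)}) + g * P {ω | τ ω ≤ N} := by ring
        _ ≤ (P {ω | (N : ℕ∞) < τ ω}
            + ∫⁻ ω in {ω | (N : ℕ∞) < τ ω}, shiryaevRoberts L N ω ∂P) + g * P {ω | τ ω ≤ N} := by
            exact add_le_add_left (hge.trans hmain) _
        _ = (∫⁻ ω in {ω | (N : ℕ∞) < τ ω}, shiryaevRoberts L N ω ∂P + g * P {ω | τ ω ≤ N})
            + P {ω | (N : ℕ∞) < τ ω} := by ring
        _ ≤ _ := by rw [Finset.sum_range_succ]; gcongr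
  rw [lintegral_eq_tsum_lt hτ]
  have hN : ∀ N : ℕ, g * P {ω | τ ω ≤ N} ≤ ∑' m : ℕ, P {ω | (m : ℕ∞) < τ ω} := fun N =>
    (le_add_self.trans (key N)).trans (ENNReal.sum_le_tsum _)
  have hlim : Tendsto (fun N : ℕ => P {ω | τ ω ≤ N}) atTop (𝓝 (P (⋃ N : ℕ, {ω | τ ω ≤ N}))) :=
    tendsto_measure_iUnion_atTop fun a b hab ω (hω : τ ω ≤ a) =>
      hω.trans (by exact_mod_cast hab : (a : ℕ∞) ≤ b)
  -- Letting `N` grow gives `g` only if `τ` is almost surely finite; otherwise its mean is infinite.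
  by_cases htop : P {ω | τ ω = ⊤} = 0
  · have hone : P (⋃ N : ℕ, {ω | τ ω ≤ N}) = 1 := by
      have hc : (⋃ N : ℕ, {ω | τ ω ≤ N})ᶜ = {ω | τ ω = ⊤} := by
        ext ω
        simp only [Set.mem_compl_iff, Set.mem_iUnion, Set.mem_ofPred_eq, not_exists, not_le]
        rw [ENat.eq_top_iff_forall_gt]
      rwa [← prob_compl_eq_zero_iff (.iUnion fun N => pastAlgebra_le _ _ (hτ N)), hc]
    rw [hone] at hlim
    by_cases hg : g = 0
    · simp [hg]
    have := ENNReal.Tendsto.const_mul (a := g) hlim (Or.inl one_ne_zero)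
    rw [mul_one] at this
    exact le_of_tendsto' this hN
  · have : ∑' m : ℕ, P {ω | (m : ℕ∞) < τ ω} = ⊤ := by
      rw [← top_le_iff, ← ENNReal.tsum_const_eq_top_of_ne_zero (α := ℕ) htop]
      refine ENNReal.tsum_le_tsum fun m => measure_mono fun ω (hω : τ ω = ⊤) => ?_
      simp [hω]
    rw [this]; exact le_top

end RunningLength

/-! ### Wald's bound for the first crossing of a random walk -/

section Wald

variable {E : Type*} [MeasurableSpace E] (μ : ℕ → Measure E) [∀ t, IsProbabilityMeasure (μ t)]

/-- Paths in `A` along which the walk with increments `y (ω v), y (ω (v + 1)), …` stays below `b`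
during its first `m` steps. -/
def belowSet (y : E → ℝ) (b : ℝ) (v : ℕ) (A : Set (ℕ → E)) (m : ℕ) : Set (ℕ → E) :=
  {ω | ω ∈ A ∧ ∀ j, 1 ≤ j → j ≤ m → ∑ i ∈ Finset.range j, y (ω (v + i)) < b}

lemma measurableSet_belowSet {y : E → ℝ} (hy : Measurable y) (b : ℝ) {v : ℕ} {A : Set (ℕ → E)}
    (hA : MeasurableSet[pastAlgebra E v] A) (m : ℕ) :
    MeasurableSet[pastAlgebra E (v + m)] (belowSet y b v A m) := by
  have : belowSet y b v A m = A ∩ ⋂ (j : ℕ) (_ : 1 ≤ j) (_ : j ≤ m),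
      {ω | ∑ i ∈ Finset.range j, y (ω (v + i)) < b} := by
    ext ω; simp [belowSet]
  rw [this]
  refine MeasurableSet.inter (pastAlgebra_mono (by omega) _ hA) ?_
  refine MeasurableSet.iInter fun j => MeasurableSet.iInter fun _ => MeasurableSet.iInter fun hj => ?_
  suffices Measurable[pastAlgebra E (v + m)]
      (fun ω : ℕ → E => ∑ i ∈ Finset.range j, y (ω (v + i))) from this measurableSet_Iio
  refine Finset.measurable_fun_sum _ fun i hi => ?_
  exact hy.comp (measurable_eval_past (by have := Finset.mem_range.1 hi; omega))

/-- Wald's bound for the time a walk with increments bounded above by `c` and of mean at least `d`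
spends below `b` before its first crossing. -/
theorem sum_belowSet_le {y : E → ℝ} (hy : Measurable y) {b c d : ℝ} (hb : 0 ≤ b) (hc : 0 ≤ c)
    (hyc : ∀ x, y x ≤ c) {v : ℕ} (hint : ∀ t, v ≤ t → Integrable y (μ t))
    (hd : ∀ t, v ≤ t → d ≤ ∫ x, y x ∂(μ t)) {A : Set (ℕ → E)}
    (hA : MeasurableSet[pastAlgebra E v] A) (M : ℕ) :
    d * ∑ m ∈ Finset.range M, (Measure.infinitePi μ).real (belowSet y b v A m)
      ≤ (b + c) * (Measure.infinitePi μ).real A := by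
  set P := Measure.infinitePi μ
  -- The slack `c` pays for the overshoot: a path below `b` is at most `b + c` one step later, so
  -- `Z` stays nonnegative at the crossing step and discarding the paths that cross only lowers its
  -- integral.
  let Z : ℕ → (ℕ → E) → ℝ := fun m ω => b + c - ∑ i ∈ Finset.range m, y (ω (v + i))
  have hZi : ∀ m, Integrable (Z m) P := fun m =>
    (integrable_const _).sub (integrable_finsetSum _ fun i _ =>
      integrable_eval μ (hint (v + i) (by omega)))
  have hGm : ∀ m, MeasurableSet (belowSet y b v A m) := fun m =>
    pastAlgebra_le _ _ (measurableSet_belowSet hy b hA m)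
  have hU : ∀ m, ∀ ω ∈ belowSet y b v A m, ∑ i ∈ Finset.range m, y (ω (v + i)) ≤ b := by
    intro m ω hω
    rcases Nat.eq_zero_or_pos m with rfl | hm
    · simpa using hb
    · exact (hω.2 m hm le_rfl).le
  have key : ∀ M : ℕ, ∫ ω in belowSet y b v A M, Z M ω ∂P
      + d * ∑ m ∈ Finset.range M, P.real (belowSet y b v A m) ≤ (b + c) * P.real A := by
    intro M
    induction M with
    | zero =>
      have : belowSet y b v A 0 = A := by
        ext ω; simp only [belowSet, Set.mem_ofPred_eq, and_iff_left_iff_imp]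
        intro _ j h1 h2; omega
      rw [this]; simp [Z, mul_comm]
    | succ M ih =>
      have hsub : belowSet y b v A (M + 1) ⊆ belowSet y b v A M :=
        fun ω hω => ⟨hω.1, fun j h1 h2 => hω.2 j h1 (by omega)⟩
      have s1 : ∫ ω in belowSet y b v A (M + 1), Z (M + 1) ω ∂P
          ≤ ∫ ω in belowSet y b v A M, Z (M + 1) ω ∂P := by
        refine setIntegral_mono_set (hZi _).integrableOn ?_ hsub.eventuallyLE
        filter_upwards [ae_restrict_mem (hGm M)] with ω hω
        have h1 := hU M ω hω
        have h2 := hyc (ω (v + M))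
        simp only [Z, Finset.sum_range_succ, Pi.zero_apply]
        linarith
      have s2 : ∫ ω in belowSet y b v A M, Z (M + 1) ω ∂P
          = ∫ ω in belowSet y b v A M, Z M ω ∂P
            - ∫ ω in belowSet y b v A M, y (ω (v + M)) ∂P := by
        rw [← integral_sub (hZi M).integrableOn
          (integrable_eval μ (hint (v + M) (by omega))).integrableOn]
        refine integral_congr_ae (ae_of_all _ fun ω => ?_)
        simp only [Z, Finset.sum_range_succ]; ring
      have s3 : d * P.real (belowSet y b v A M)
          ≤ ∫ ω in belowSet y b v A M, y (ω (v + M)) ∂P := by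
        rw [setIntegral_past_eval μ (measurableSet_belowSet hy b hA M) hy, mul_comm]
        exact mul_le_mul_of_nonneg_left (hd _ (by omega)) measureReal_nonneg
      rw [Finset.sum_range_succ, mul_add]
      linarith
  have hnn : 0 ≤ ∫ ω in belowSet y b v A M, Z M ω ∂P := by
    refine setIntegral_nonneg (hGm M) fun ω hω => ?_
    have := hU M ω hω
    simp only [Z]; linarith
  linarith [key M]

theorem tsum_belowSet_le {y : E → ℝ} (hy : Measurable y) {b c d : ℝ} (hb : 0 ≤ b) (hc : 0 ≤ c)
    (hd0 : 0 < d) (hyc : ∀ x, y x ≤ c) {v : ℕ} (hint : ∀ t, v ≤ t → Integrable y (μ t))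
    (hd : ∀ t, v ≤ t → d ≤ ∫ x, y x ∂(μ t)) {A : Set (ℕ → E)}
    (hA : MeasurableSet[pastAlgebra E v] A) :
    ∑' m : ℕ, (Measure.infinitePi μ) (belowSet y b v A m)
      ≤ ENNReal.ofReal ((b + c) / d) * Measure.infinitePi μ A := by
  rw [ENNReal.tsum_eq_iSup_nat]
  refine iSup_le fun M => ?_
  have h := sum_belowSet_le μ hy hb hc hyc hint hd hA M
  rw [mul_comm, ← le_div_iff₀ hd0] at h
  rw [← ofReal_measureReal (s := A), ← ENNReal.ofReal_mul (by positivity)]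
  rw [Finset.sum_congr rfl fun m _ =>
    (ofReal_measureReal (μ := Measure.infinitePi μ) (s := belowSet y b v A m)).symm,
    ← ENNReal.ofReal_sum_of_nonneg fun _ _ => measureReal_nonneg]
  exact ENNReal.ofReal_le_ofReal (h.trans_eq (by ring))

end Wald

/-! ### Lower bound on the delay for two simple hypotheses -/

section ChangePoint

variable {E : Type*} [MeasurableSpace E] (P₀ P₁ : Measure E) [IsProbabilityMeasure P₀]
  [IsProbabilityMeasure P₁]

/-- The marginal laws of an independent sequence with law `P₀` before index `v` and `P₁` from index
`v` on. -/
def changeLaw (v t : ℕ) : Measure E := if t < v then P₀ else P₁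

instance (v t : ℕ) : IsProbabilityMeasure (changeLaw P₀ P₁ v t) := by
  unfold changeLaw; split_ifs <;> infer_instance

variable {P₀ P₁}

/-- Each inverse density turns one coordinate back from `P₁` to `P₀`, so `k` of them move the change
from `v` to `v + k`. -/
lemma lintegral_mul_prod_inv_density_le {L : E → ℝ≥0∞} (hL : Measurable L)
    (hP : P₁ = P₀.withDensity L) (k : ℕ) : ∀ (v : ℕ) {f : (ℕ → E) → ℝ≥0∞}, Measurable f →
    ∫⁻ ω, f ω * ∏ i ∈ Finset.range k, (L (ω (v + i)))⁻¹
        ∂(Measure.infinitePi (changeLaw P₀ P₁ v))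
      ≤ ∫⁻ ω, f ω ∂(Measure.infinitePi (changeLaw P₀ P₁ (v + k))) := by
  induction k with
  | zero => intro v f hf; simp
  | succ k ih =>
    intro v f hf
    have hprod : Measurable fun ω : ℕ → E => ∏ i ∈ Finset.range k, (L (ω (v + 1 + i)))⁻¹ :=
      Finset.measurable_fun_prod _ fun i _ => (hL.comp (measurable_pi_apply _)).inv
    have h1 : ∀ ω : ℕ → E, f ω * ∏ i ∈ Finset.range (k + 1), (L (ω (v + i)))⁻¹
        = (f ω * ∏ i ∈ Finset.range k, (L (ω (v + 1 + i)))⁻¹) * (L (ω v))⁻¹ := by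
      intro ω
      have h2 : ∀ i ∈ Finset.range k, (L (ω (v + (i + 1))))⁻¹ = (L (ω (v + 1 + i)))⁻¹ :=
        fun i _ => by rw [show v + (i + 1) = v + 1 + i by ring]
      rw [Finset.prod_range_succ', add_zero, mul_assoc, Finset.prod_congr rfl h2]
    rw [lintegral_congr h1]
    refine (lintegral_mul_inv_density_le (μ := changeLaw P₀ P₁ (v + 1))
      (μ' := changeLaw P₀ P₁ v) hL ?_ ?_ (hf.mul hprod)).trans ?_
    · intro i hi
      unfold changeLaw
      congr 1
      exact propext ⟨fun h => by omega, fun h => by omega⟩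
    · simp [changeLaw, hP]
    · have := ih (v + 1) hf
      rwa [show v + 1 + k = v + (k + 1) by ring] at this

variable {τ : (ℕ → E) → ℕ∞}

lemma changeLaw_eq_of_past {v : ℕ} {A : Set (ℕ → E)} (hA : MeasurableSet[pastAlgebra E v] A) :
    Measure.infinitePi (changeLaw P₀ P₁ v) A = Measure.infinitePi (fun _ : ℕ => P₀) A :=
  infinitePi_eq_of_past (fun s hs => by simp [changeLaw, hs]) hA

/-- Change of measure for events that are determined `k` steps after the change. -/
lemma setLIntegral_prod_inv_density_le {L : E → ℝ≥0∞} (hL : Measurable L)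
    (hP : P₁ = P₀.withDensity L) {v k : ℕ} {B : Set (ℕ → E)}
    (hB : MeasurableSet[pastAlgebra E (v + k)] B) :
    ∫⁻ ω, B.indicator (fun ω => ∏ i ∈ Finset.range k, (L (ω (v + i)))⁻¹) ω
        ∂(Measure.infinitePi (changeLaw P₀ P₁ v))
      ≤ Measure.infinitePi (fun _ : ℕ => P₀) B := by
  have hB' := pastAlgebra_le _ _ hB
  have h := lintegral_mul_prod_inv_density_le hL hP k v
    (f := B.indicator 1) (measurable_one.indicator hB')
  rw [lintegral_indicator_one hB', changeLaw_eq_of_past hB] at h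
  refine le_trans (lintegral_mono fun ω => ?_) h
  by_cases hω : ω ∈ B <;> simp [hω]

/-- The log-likelihood accumulated after the change until `τ`, but for at most `m` steps. -/
def stoppedLogLik (L : E → ℝ≥0∞) (τ : (ℕ → E) → ℕ∞) (v m : ℕ) (ω : ℕ → E) : ℝ :=
  ∑ i ∈ Finset.range m,
    {ω | ((v + i : ℕ) : ℕ∞) < τ ω}.indicator (fun ω => Real.log (L (ω (v + i))).toReal) ω

omit [MeasurableSpace E] in
lemma stoppedLogLik_eq (L : E → ℝ≥0∞) {v m k : ℕ} {ω : ℕ → E} (hk : k ≤ m)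
    (h : ∀ i < m, ((v + i : ℕ) : ℕ∞) < τ ω ↔ i < k) :
    stoppedLogLik L τ v m ω = ∑ i ∈ Finset.range k, Real.log (L (ω (v + i))).toReal := by
  unfold stoppedLogLik
  rw [← Finset.sum_subset (Finset.range_mono hk)]
  · refine Finset.sum_congr rfl fun i hi => ?_
    have hi' := Finset.mem_range.1 hi
    exact Set.indicator_of_mem (show ω ∈ {ω | ((v + i : ℕ) : ℕ∞) < τ ω} from
      (h i (by omega)).2 hi') _
  · intro i hi hi'
    refine Set.indicator_of_notMem (s := {ω | ((v + i : ℕ) : ℕ∞) < τ ω})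
      (fun hω : ((v + i : ℕ) : ℕ∞) < τ ω => hi' ?_) _
    exact Finset.mem_range.2 ((h i (Finset.mem_range.1 hi)).1 hω)

omit [MeasurableSpace E] in
lemma ofReal_exp_neg_sum_log {L : E → ℝ≥0∞} {k v : ℕ} {ω : ℕ → E}
    (hω : ∀ t, v ≤ t → 0 < L (ω t) ∧ L (ω t) < ⊤) :
    ENNReal.ofReal (Real.exp (-∑ i ∈ Finset.range k, Real.log (L (ω (v + i))).toReal))
      = ∏ i ∈ Finset.range k, (L (ω (v + i)))⁻¹ := by
  rw [← Finset.sum_neg_distrib, Real.exp_sum, ENNReal.ofReal_prod_of_nonneg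
    fun _ _ => (Real.exp_pos _).le]
  refine Finset.prod_congr rfl fun i _ => ?_
  obtain ⟨h1, h2⟩ := hω (v + i) (by omega)
  have h3 := ENNReal.toReal_pos h1.ne' h2.ne
  rw [Real.exp_neg, Real.exp_log h3, ENNReal.ofReal_inv_of_pos h3, ENNReal.ofReal_toReal h2.ne]

/-- The window is split by the value of `τ`. On `τ = v + i + 1` exactly the `i + 1` samples with
indices `v, …, v + i` have been accumulated and the event is determined by them and the past, so the
change of measure applies with `i + 1` factors. The paths that outlast the window carry all `m`
factors and no `exp lam`. -/
lemma setLIntegral_exp_stoppedLogLik_le {L : E → ℝ≥0∞} (hL : Measurable L)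
    (hP : P₁ = P₀.withDensity L) (hLpos : ∀ᵐ x ∂P₁, 0 < L x ∧ L x < ⊤)
    (hτ : ∀ t : ℕ, MeasurableSet[pastAlgebra E t] {ω | τ ω ≤ t}) {lam : ℝ} (v m : ℕ) :
    ∫⁻ ω, {ω | (v : ℕ∞) < τ ω}.indicator (fun ω => ENNReal.ofReal (Real.exp
        ({ω | (v : ℕ∞) < τ ω ∧ τ ω ≤ (v + m : ℕ)}.indicator (fun _ => lam) ω
          - stoppedLogLik L τ v m ω))) ω ∂(Measure.infinitePi (changeLaw P₀ P₁ v))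
      ≤ ENNReal.ofReal (Real.exp lam)
          * Measure.infinitePi (fun _ : ℕ => P₀) {ω | (v : ℕ∞) < τ ω ∧ τ ω ≤ (v + m : ℕ)}
        + Measure.infinitePi (fun _ : ℕ => P₀) {ω | ((v + m : ℕ) : ℕ∞) < τ ω} := by
  set Q := Measure.infinitePi (changeLaw P₀ P₁ v)
  let B : ℕ → Set (ℕ → E) := fun i => {ω | τ ω = (v + i + 1 : ℕ)}
  let D : ℕ → (ℕ → E) → ℝ≥0∞ := fun k ω => ∏ i ∈ Finset.range k, (L (ω (v + i)))⁻¹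
  have hBm : ∀ i, MeasurableSet[pastAlgebra E (v + (i + 1))] (B i) := fun i =>
    measurableSet_eq_of_stopping hτ (v + i)
  have hCm := measurableSet_lt_of_stopping hτ (v + m)
  have hDm : ∀ k, Measurable (D k) := fun k =>
    Finset.measurable_fun_prod _ fun i _ => (hL.comp (measurable_pi_apply _)).inv
  have hgood : ∀ᵐ ω ∂Q, ∀ t, v ≤ t → 0 < L (ω t) ∧ L (ω t) < ⊤ := by
    rw [ae_all_iff]; intro t
    by_cases ht : v ≤ t
    · have := ae_eval (changeLaw P₀ P₁ v) (t := t) (p := fun x => 0 < L x ∧ L x < ⊤)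
        (by simpa [changeLaw, not_lt.2 ht] using hLpos)
      filter_upwards [this] with ω hω _ using hω
    · exact ae_of_all _ fun ω h => absurd h ht
  have hpt : ∀ᵐ ω ∂Q, {ω | (v : ℕ∞) < τ ω}.indicator (fun ω => ENNReal.ofReal (Real.exp
        ({ω | (v : ℕ∞) < τ ω ∧ τ ω ≤ (v + m : ℕ)}.indicator (fun _ => lam) ω
          - stoppedLogLik L τ v m ω))) ω
      ≤ (∑ i ∈ Finset.range m, ENNReal.ofReal (Real.exp lam) * (B i).indicator (D (i + 1)) ω)
        + {ω | ((v + m : ℕ) : ℕ∞) < τ ω}.indicator (D m) ω := by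
    filter_upwards [hgood] with ω hω
    by_cases hA : ω ∈ {ω | (v : ℕ∞) < τ ω}
    swap
    · rw [Set.indicator_of_notMem hA]; exact zero_le
    rw [Set.indicator_of_mem hA]
    by_cases hC : ω ∈ {ω | ((v + m : ℕ) : ℕ∞) < τ ω}
    · have hG : ω ∉ {ω | (v : ℕ∞) < τ ω ∧ τ ω ≤ (v + m : ℕ)} := fun h => not_lt.2 h.2 hC
      rw [Set.indicator_of_mem hC, Set.indicator_of_notMem hG, zero_sub,
        stoppedLogLik_eq L (k := m) le_rfl, ofReal_exp_neg_sum_log hω]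
      · exact le_add_self
      · intro i hi
        refine iff_of_true (lt_of_le_of_lt ?_ hC) hi
        exact_mod_cast (by omega : v + i ≤ v + m)
    · have hC' : τ ω ≤ (v + m : ℕ) := not_lt.1 hC
      have hG : ω ∈ {ω | (v : ℕ∞) < τ ω ∧ τ ω ≤ (v + m : ℕ)} := ⟨hA, hC'⟩
      obtain ⟨n, hn⟩ := ENat.ne_top_iff_exists.1 (ne_top_of_le_ne_top (ENat.natCast_ne_top _) hC')
      have hA' : v < n := by
        have : (v : ℕ∞) < τ ω := hA
        rw [← hn] at this; exact_mod_cast this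
      rw [← hn] at hC'
      have hC'' : n ≤ v + m := by exact_mod_cast hC'
      obtain ⟨i, rfl⟩ : ∃ i, n = v + i + 1 := ⟨n - v - 1, by omega⟩
      have hB : ω ∈ B i := hn.symm
      rw [Set.indicator_of_mem hG, stoppedLogLik_eq L (k := i + 1) (by omega), sub_eq_add_neg,
        Real.exp_add, ENNReal.ofReal_mul (Real.exp_pos _).le, ofReal_exp_neg_sum_log hω]
      · refine le_add_right (le_trans ?_ (Finset.single_le_sum (fun _ _ => zero_le)
          (Finset.mem_range.2 (by omega : i < m))))
        rw [Set.indicator_of_mem hB]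
      · intro j hj
        rw [← hn]; norm_cast; omega
  refine (lintegral_mono_ae hpt).trans ?_
  rw [lintegral_add_right _ ((hDm m).indicator (pastAlgebra_le _ _ hCm)),
    lintegral_finsetSum _ fun i _ =>
      ((hDm (i + 1)).indicator (pastAlgebra_le _ _ (hBm i))).const_mul _]
  gcongr
  · calc _ ≤ ∑ i ∈ Finset.range m, ENNReal.ofReal (Real.exp lam)
          * Measure.infinitePi (fun _ : ℕ => P₀) (B i) := by
          refine Finset.sum_le_sum fun i _ => ?_
          rw [lintegral_const_mul _ ((hDm (i + 1)).indicator (pastAlgebra_le _ _ (hBm i)))]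
          gcongr
          exact setLIntegral_prod_inv_density_le hL hP (hBm i)
      _ = ENNReal.ofReal (Real.exp lam)
          * Measure.infinitePi (fun _ : ℕ => P₀) (⋃ i ∈ Finset.range m, B i) := by
          rw [← Finset.mul_sum, measure_biUnion_finset]
          · intro i _ j _ hij
            rw [Function.onFun, Set.disjoint_left]
            intro ω (h1 : τ ω = _) (h2 : τ ω = _)
            rw [h1] at h2
            have : v + i + 1 = v + j + 1 := by exact_mod_cast h2
            omega
          · exact fun i _ => pastAlgebra_le _ _ (hBm i)
      _ ≤ _ := by
          gcongr
          refine Set.iUnion₂_subset fun i hi ω (hω : τ ω = _) => ?_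
          have hi' := Finset.mem_range.1 hi
          simp only [Set.mem_ofPred_eq, hω]
          norm_cast; omega
  · exact setLIntegral_prod_inv_density_le hL hP hCm

/-- Wald's identity: the decision to continue at `v + i` depends on the past only, so the next
increment is independent of it. -/
lemma integral_stoppedLogLik {L : E → ℝ≥0∞} (hL : Measurable L)
    (hint : Integrable (fun x => Real.log (L x).toReal) P₁)
    (hτ : ∀ t : ℕ, MeasurableSet[pastAlgebra E t] {ω | τ ω ≤ t}) (v m : ℕ) :
    Integrable (stoppedLogLik L τ v m) (Measure.infinitePi (changeLaw P₀ P₁ v)) ∧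
    ∫ ω, stoppedLogLik L τ v m ω ∂(Measure.infinitePi (changeLaw P₀ P₁ v))
      = (∑ i ∈ Finset.range m, (Measure.infinitePi (changeLaw P₀ P₁ v)).real
          {ω | ((v + i : ℕ) : ℕ∞) < τ ω}) * ∫ x, Real.log (L x).toReal ∂P₁ := by
  have hm : Measurable fun x => Real.log (L x).toReal := Real.measurable_log.comp hL.ennreal_toReal
  have hlt := measurableSet_lt_of_stopping hτ
  have hi : ∀ i, Integrable ({ω | ((v + i : ℕ) : ℕ∞) < τ ω}.indicator
      (fun ω : ℕ → E => Real.log (L (ω (v + i))).toReal))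
      (Measure.infinitePi (changeLaw P₀ P₁ v)) := fun i =>
    (integrable_eval (changeLaw P₀ P₁ v) (t := v + i)
      (by simpa [changeLaw] using hint)).indicator (pastAlgebra_le _ _ (hlt _))
  refine ⟨integrable_finsetSum _ fun i _ => hi i, ?_⟩
  unfold stoppedLogLik
  rw [integral_finsetSum _ fun i _ => hi i, Finset.sum_mul]
  refine Finset.sum_congr rfl fun i _ => ?_
  rw [integral_indicator (pastAlgebra_le _ _ (hlt _)),
    setIntegral_past_eval (changeLaw P₀ P₁ v) (hlt (v + i)) hm]
  simp [changeLaw]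

/-- The one-change-point inequality between the delay and the false alarm probability in a window
of length `m`. -/
lemma window_inequality {L : E → ℝ≥0∞} (hL : Measurable L)
    (hP : P₁ = P₀.withDensity L) (hLpos : ∀ᵐ x ∂P₁, 0 < L x ∧ L x < ⊤)
    (hint : Integrable (fun x => Real.log (L x).toReal) P₁)
    (hI : 0 ≤ ∫ x, Real.log (L x).toReal ∂P₁)
    (hτ : ∀ t : ℕ, MeasurableSet[pastAlgebra E t] {ω | τ ω ≤ t}) {lam W : ℝ} (hlam : 0 ≤ lam)
    {v m : ℕ} (hm : 1 ≤ m)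
    (hW : ∀ M : ℕ, ∑ i ∈ Finset.range M, (Measure.infinitePi (changeLaw P₀ P₁ v)).real
        {ω | ((v + 1 + i : ℕ) : ℕ∞) < τ ω}
      ≤ W * (Measure.infinitePi (changeLaw P₀ P₁ v)).real {ω | (v : ℕ∞) < τ ω}) :
    (lam * (1 - W / m) - (∫ x, Real.log (L x).toReal ∂P₁) * (W + 1))
        * (Measure.infinitePi (fun _ : ℕ => P₀)).real {ω | (v : ℕ∞) < τ ω}
      ≤ Real.exp lam * ((Measure.infinitePi (fun _ : ℕ => P₀)).real {ω | (v : ℕ∞) < τ ω}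
        - (Measure.infinitePi (fun _ : ℕ => P₀)).real {ω | ((v + m : ℕ) : ℕ∞) < τ ω}) := by
  set Q := Measure.infinitePi (changeLaw P₀ P₁ v)
  set P := Measure.infinitePi (fun _ : ℕ => P₀)
  set I := ∫ x, Real.log (L x).toReal ∂P₁
  set A : Set (ℕ → E) := {ω | (v : ℕ∞) < τ ω} with hAdef
  set C : Set (ℕ → E) := {ω | ((v + m : ℕ) : ℕ∞) < τ ω} with hCdef
  set G : Set (ℕ → E) := {ω | (v : ℕ∞) < τ ω ∧ τ ω ≤ (v + m : ℕ)} with hGdef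
  have hAm := measurableSet_lt_of_stopping hτ v
  have hA := pastAlgebra_le _ _ hAm
  have hC : MeasurableSet C := pastAlgebra_le _ _ (measurableSet_lt_of_stopping hτ (v + m))
  have hGA : G = A \ C := by ext ω; simp [hAdef, hCdef, hGdef]
  have hCA : C ⊆ A := by
    intro ω hω
    have h1 : ((v + m : ℕ) : ℕ∞) < τ ω := hω
    have h2 : (v : ℕ∞) ≤ ((v + m : ℕ) : ℕ∞) := by exact_mod_cast (by omega : v ≤ v + m)
    exact h2.trans_lt h1
  have hG : MeasurableSet G := hGA ▸ hA.diff hC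
  have hQA : Q.real A = P.real A := by
    simp only [measureReal_def]; rw [changeLaw_eq_of_past hAm]
  have hQG : Q.real G = Q.real A - Q.real C := by rw [hGA, measureReal_sdiff hCA hC]
  have hPG : P.real G = P.real A - P.real C := by rw [hGA, measureReal_sdiff hCA hC]
  obtain ⟨hXi, hX⟩ := integral_stoppedLogLik (P₀ := P₀) hL hint hτ v m
  -- the accumulated log-likelihood has a small mean
  have hsum : ∑ i ∈ Finset.range m, Q.real {ω | ((v + i : ℕ) : ℕ∞) < τ ω}
      ≤ (W + 1) * Q.real A := by
    obtain ⟨k, rfl⟩ : ∃ k, m = k + 1 := ⟨m - 1, by omega⟩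
    rw [Finset.sum_range_succ', add_zero]
    have := hW k
    rw [Finset.sum_congr rfl fun i _ => by rw [show v + 1 + i = v + (i + 1) by ring]] at this
    linarith
  -- Markov's inequality
  have hmark : Q.real C ≤ W / m * Q.real A := by
    have h1 : (m : ℝ) * Q.real C
        ≤ ∑ i ∈ Finset.range m, Q.real {ω | ((v + 1 + i : ℕ) : ℕ∞) < τ ω} := by
      rw [← nsmul_eq_mul, ← Finset.card_range m, ← Finset.sum_const, Finset.card_range]
      refine Finset.sum_le_sum fun i hi => measureReal_mono ?_
      intro ω hω
      have hi' := Finset.mem_range.1 hi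
      have h2 : ((v + 1 + i : ℕ) : ℕ∞) ≤ ((v + m : ℕ) : ℕ∞) := by
        exact_mod_cast (by omega : v + 1 + i ≤ v + m)
      exact h2.trans_lt hω
    have h2 := h1.trans (hW m)
    have hm0 : (0 : ℝ) < m := by exact_mod_cast hm
    rw [div_mul_eq_mul_div, le_div_iff₀ hm0]; linarith
  -- integrate `x + 1 ≤ exp x`
  have hXA : ∀ ω, A.indicator (stoppedLogLik L τ v m) ω = stoppedLogLik L τ v m ω := by
    intro ω
    by_cases hω : ω ∈ A
    · rw [Set.indicator_of_mem hω]
    · rw [Set.indicator_of_notMem hω, stoppedLogLik_eq L (k := 0) (Nat.zero_le _)]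
      · simp
      · intro i _
        refine iff_of_false (fun h => hω ?_) (Nat.not_lt_zero _)
        exact lt_of_le_of_lt (by exact_mod_cast (by omega : v ≤ v + i)) h
  let F : (ℕ → E) → ℝ := fun ω => G.indicator (fun _ => lam) ω - stoppedLogLik L τ v m ω
    + A.indicator (fun _ => (1 : ℝ)) ω
  have hGi : Integrable (G.indicator fun _ => lam) Q := (integrable_const _).indicator hG
  have hAi : Integrable (A.indicator fun _ => (1 : ℝ)) Q := (integrable_const _).indicator hA
  have hF : ∫ ω, F ω ∂Q = lam * Q.real G
      - (∑ i ∈ Finset.range m, Q.real {ω | ((v + i : ℕ) : ℕ∞) < τ ω}) * I + Q.real A := by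
    have s1 := integral_add (hGi.sub hXi) hAi
    have s2 := integral_sub hGi hXi
    simp only [Pi.sub_apply] at s1
    simp only [F]
    rw [s1, s2, hX, integral_indicator_const _ hG, integral_indicator_const _ hA, smul_eq_mul,
      smul_eq_mul, mul_one, mul_comm lam]
  have hFle : ∫ ω, F ω ∂Q ≤ Real.exp lam * P.real G + P.real C := by
    have hub := setLIntegral_exp_stoppedLogLik_le (lam := lam) hL hP hLpos hτ v m
    have h1 : ∫⁻ ω, ENNReal.ofReal (F ω) ∂Q ≤ ENNReal.ofReal (Real.exp lam) * P G + P C := by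
      refine le_trans (lintegral_mono fun ω => ?_) hub
      by_cases hω : ω ∈ A
      · rw [Set.indicator_of_mem hω]
        simp only [F]
        rw [Set.indicator_of_mem hω]
        exact ENNReal.ofReal_le_ofReal (Real.add_one_le_exp _)
      · have hωG : ω ∉ G := fun h => hω h.1
        simp only [F]
        rw [← hXA ω, Set.indicator_of_notMem hω, Set.indicator_of_notMem hω,
          Set.indicator_of_notMem hωG]
        simp
    have hfin : ENNReal.ofReal (Real.exp lam) * P G + P C ≠ ⊤ := by finiteness
    have hFi : Integrable F Q := (hGi.sub hXi).add hAi
    rw [integral_eq_lintegral_pos_part_sub_lintegral_neg_part hFi]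
    have h2 := ENNReal.toReal_mono hfin h1
    rw [ENNReal.toReal_add (by finiteness) (by finiteness), ENNReal.toReal_mul,
      ENNReal.toReal_ofReal (Real.exp_pos _).le] at h2
    have h3 : 0 ≤ (∫⁻ ω, ENNReal.ofReal (-F ω) ∂Q).toReal := ENNReal.toReal_nonneg
    simp only [measureReal_def]
    linarith
  -- `P.real C ≤ P.real A` cancels the term `Q.real A` that came from the 1 in `x + 1 ≤ exp x`.
  have hPC : P.real C ≤ P.real A := measureReal_mono hCA
  have m1 : lam * Q.real C ≤ lam * (W / m * Q.real A) := mul_le_mul_of_nonneg_left hmark hlam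
  have m2 := mul_le_mul_of_nonneg_right hsum hI
  rw [hF, hQG, hPG] at hFle
  rw [hQA] at *
  linarith

/-- Non-asymptotic lower bound: a stopping time whose conditional mean delays are at most `W` and
whose mean without change is at least `γ` satisfies, for every window length `m ≤ γ`, a linear
inequality that bounds `W` from below. -/
theorem delay_lower_bound {L : E → ℝ≥0∞} (hL : Measurable L)
    (hP : P₁ = P₀.withDensity L) (hLpos : ∀ᵐ x ∂P₁, 0 < L x ∧ L x < ⊤)
    (hint : Integrable (fun x => Real.log (L x).toReal) P₁)
    (hI : 0 ≤ ∫ x, Real.log (L x).toReal ∂P₁)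
    (hτ : ∀ t : ℕ, MeasurableSet[pastAlgebra E t] {ω | τ ω ≤ t}) {γ W : ℝ}
    {m : ℕ} (hm : 1 ≤ m) (hmγ : (m : ℝ) ≤ γ)
    (hγ : ENNReal.ofReal γ ≤ ∫⁻ ω, (τ ω : ℝ≥0∞) ∂(Measure.infinitePi fun _ : ℕ => P₀))
    (hW : ∀ v M : ℕ, ∑ i ∈ Finset.range M, (Measure.infinitePi (changeLaw P₀ P₁ v)).real
        {ω | ((v + 1 + i : ℕ) : ℕ∞) < τ ω}
      ≤ W * (Measure.infinitePi (changeLaw P₀ P₁ v)).real {ω | (v : ℕ∞) < τ ω}) :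
    Real.log (γ / m) * (1 - W / m) - (∫ x, Real.log (L x).toReal ∂P₁) * (W + 1) ≤ 1 := by
  set P := Measure.infinitePi (fun _ : ℕ => P₀)
  set I := ∫ x, Real.log (L x).toReal ∂P₁
  have hm0 : (0 : ℝ) < m := by exact_mod_cast hm
  have hγ0 : 0 < γ := hm0.trans_le hmγ
  have hlam : 0 ≤ Real.log (γ / m) := Real.log_nonneg ((one_le_div hm0).2 hmγ)
  have hexp : Real.exp (Real.log (γ / m)) = γ / m := Real.exp_log (by positivity)
  set κ := Real.log (γ / m) * (1 - W / m) - I * (W + 1)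
  let p : ℕ → ℝ := fun v => P.real {ω | (v : ℕ∞) < τ ω}
  have hp0 : ∀ v, 0 ≤ p v := fun v => measureReal_nonneg
  have hp1 : ∀ v, p v ≤ 1 := fun v => measureReal_le_one
  have hstep : ∀ v, κ * p v ≤ γ / m * (p v - p (v + m)) := fun v => by
    have := window_inequality (v := v) hL hP hLpos hint hI hτ hlam hm (hW v)
    rwa [hexp] at this
  by_cases hκ : κ ≤ 0
  · linarith
  push Not at hκ
  -- A shift by `m` leaves only the first `m` probabilities, each at most 1. With `exp lam = γ / m`
  -- the total is at most `γ`, uniformly in `N`, so no particular change-point has to be selected.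
  have htele : ∀ N : ℕ, ∑ v ∈ Finset.range N, (p v - p (v + m)) ≤ m := by
    intro N
    rw [Finset.sum_sub_distrib]
    have e1 := Finset.sum_range_add p m N
    have e2 : ∑ v ∈ Finset.range N, p v ≤ ∑ v ∈ Finset.range (m + N), p v :=
      Finset.sum_le_sum_of_subset_of_nonneg (Finset.range_mono (by omega)) fun i _ _ => hp0 i
    have e3 : ∑ v ∈ Finset.range m, p v ≤ m := by
      simpa using Finset.sum_le_sum fun i (_ : i ∈ Finset.range m) => hp1 i
    simp_rw [add_comm m] at e1 e2
    linarith
  have hbound : ∀ N : ℕ, ∑ v ∈ Finset.range N, p v ≤ γ / κ := by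
    intro N
    rw [le_div_iff₀ hκ, mul_comm, Finset.mul_sum]
    calc ∑ v ∈ Finset.range N, κ * p v ≤ ∑ v ∈ Finset.range N, γ / m * (p v - p (v + m)) :=
          Finset.sum_le_sum fun v _ => hstep v
      _ = γ / m * ∑ v ∈ Finset.range N, (p v - p (v + m)) := by rw [Finset.mul_sum]
      _ ≤ γ / m * m := by gcongr; exact htele N
      _ = γ := div_mul_cancel₀ _ hm0.ne'
  -- The sum of `p` is the mean of `τ`, at least `γ`; together with the bound `γ / κ` this forces `κ
  -- ≤ 1`.
  rw [lintegral_eq_tsum_lt hτ, ENNReal.tsum_eq_iSup_nat] at hγ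
  have hle : ENNReal.ofReal γ ≤ ENNReal.ofReal (γ / κ) := by
    refine hγ.trans (iSup_le fun N => ?_)
    rw [Finset.sum_congr rfl fun (v : ℕ) _ => (ofReal_measureReal (μ := P)
      (s := {ω | (v : ℕ∞) < τ ω})).symm, ← ENNReal.ofReal_sum_of_nonneg fun v _ => hp0 v]
    exact ENNReal.ofReal_le_ofReal (hbound N)
  rw [ENNReal.ofReal_le_ofReal_iff (by positivity), le_div_iff₀ hκ] at hle
  nlinarith

end ChangePoint

/-! ### Permutation symmetry of the mixtures and the drift of the log-likelihood ratio -/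

namespace SensorNetwork

variable {𝒳 : Type*} [MeasurableSpace 𝒳] {K n : ℕ} (M : SensorNetwork 𝒳 K n)

instance isProbabilityMeasure_group (g : Fin K ⊕ Fin K) :
    IsProbabilityMeasure (Sum.elim M.pre M.post g) := by
  cases g with
  | inl k => exact M.pre_prob k
  | inr k => exact M.post_prob k

instance isProbabilityMeasure_sampleLaw (σ : Fin n → Fin K ⊕ Fin K) :
    IsProbabilityMeasure (M.sampleLaw σ) := by
  unfold sampleLaw; infer_instance

lemma mem_labels {s : Option (Fin K)} {σ : Fin n → Fin K ⊕ Fin K} :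
    σ ∈ M.labels s ↔ ∀ g, Nat.card {i // σ i = g} = M.groupSize s g := by
  classical
  simp only [labels, Finset.mem_filter, Finset.mem_univ, true_and]
  refine forall_congr' fun g => ?_
  rw [Nat.card_eq_fintype_card, Fintype.card_subtype]

lemma sum_groupSize (s : Option (Fin K)) : ∑ g, M.groupSize s g = n := by
  rw [Fintype.sum_sum_type, ← Finset.sum_add_distrib]
  refine Eq.trans ?_ M.count_sum
  refine Finset.sum_congr rfl fun k _ => ?_
  -- Makes the truncated `M.count k - 1` a true subtraction.
  have := M.count_pos k
  simp only [groupSize]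
  split_ifs <;> omega

lemma labels_nonempty (s : Option (Fin K)) : (M.labels s).Nonempty := by
  let e : Fin n ≃ Σ g, Fin (M.groupSize s g) := Fintype.equivOfCardEq (by
    rw [Fintype.card_sigma]; simp [M.sum_groupSize s])
  refine ⟨fun i => (e i).1, M.mem_labels.2 fun g => ?_⟩
  have e1 : {i // (e i).1 = g} ≃ {p : Σ g, Fin (M.groupSize s g) // p.1 = g} :=
    e.subtypeEquiv fun _ => Iff.rfl
  rw [Nat.card_congr (e1.trans (Equiv.sigmaSubtype g))]
  simp

lemma mem_labels_comp {s : Option (Fin K)} {σ : Fin n → Fin K ⊕ Fin K} (hσ : σ ∈ M.labels s)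
    (e : Equiv.Perm (Fin n)) : σ ∘ e ∈ M.labels s := by
  rw [mem_labels] at *
  intro g
  rw [← hσ g]
  exact Nat.card_congr (e.subtypeEquiv fun _ => Iff.rfl)

/-- Labels of one type have fibres of equal sizes; bijections between the fibres glue to a
permutation. -/
lemma exists_perm_of_mem_labels {s : Option (Fin K)} {σ σ' : Fin n → Fin K ⊕ Fin K}
    (hσ : σ ∈ M.labels s) (hσ' : σ' ∈ M.labels s) : ∃ e : Equiv.Perm (Fin n), σ' = σ ∘ e := by
  have h : ∀ g, Nonempty ({i // σ' i = g} ≃ {i // σ i = g}) := fun g => by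
    rw [← Finite.card_eq, M.mem_labels.1 hσ g, M.mem_labels.1 hσ' g]
  refine ⟨Equiv.ofFiberEquiv fun g => (h g).some, ?_⟩
  ext1 i
  exact (Equiv.ofFiberEquiv_map (fun g => (h g).some) i).symm

lemma card_labels_ne_zero (s : Option (Fin K)) : ((M.labels s).card : ℝ≥0∞) ≠ 0 := by
  exact_mod_cast (M.labels_nonempty s).card_pos.ne'

instance isProbabilityMeasure_mixture (s : Option (Fin K)) :
    IsProbabilityMeasure (M.mixture s) := by
  constructor
  simp only [mixture, Measure.coe_smul, Pi.smul_apply, Measure.coe_finsetSum, Finset.sum_apply,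
    measure_univ, Finset.sum_const, nsmul_eq_mul, mul_one, smul_eq_mul]
  exact ENNReal.inv_mul_cancel (M.card_labels_ne_zero s) (ENNReal.natCast_ne_top _)

lemma isProbabilityMeasure_weightedMixture {β : Fin K → ℝ} (hβ : β ∈ stdSimplex ℝ (Fin K)) :
    IsProbabilityMeasure (M.weightedMixture β) := by
  constructor
  simp only [weightedMixture, Measure.coe_smul, Pi.smul_apply, Measure.coe_finsetSum,
    Finset.sum_apply, measure_univ, mul_one, smul_eq_mul]
  rw [← ENNReal.ofReal_sum_of_nonneg fun k _ => hβ.1 k, hβ.2, ENNReal.ofReal_one]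

lemma sampleLaw_absolutelyContinuous {s : Option (Fin K)} {σ : Fin n → Fin K ⊕ Fin K}
    (hσ : σ ∈ M.labels s) : M.sampleLaw σ ≪ M.mixture s := by
  refine Measure.AbsolutelyContinuous.mk fun A _ hA => ?_
  simp only [mixture, Measure.coe_smul, Pi.smul_apply, Measure.coe_finsetSum, Finset.sum_apply,
    smul_eq_mul, mul_eq_zero, ENNReal.inv_eq_zero, ENNReal.natCast_ne_top, false_or,
    Finset.sum_eq_zero_iff] at hA
  exact hA σ hσ

/-- Reordering the samples. -/
def reorder (𝒳 : Type*) [MeasurableSpace 𝒳] (e : Equiv.Perm (Fin n)) :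
    (Fin n → 𝒳) ≃ᵐ (Fin n → 𝒳) where
  toFun x := x ∘ e
  invFun x := x ∘ e.symm
  left_inv x := by ext; simp
  right_inv x := by ext; simp
  measurable_toFun := measurable_pi_lambda _ fun i => measurable_pi_apply _
  measurable_invFun := measurable_pi_lambda _ fun i => measurable_pi_apply _

lemma sampleLaw_map_reorder (σ : Fin n → Fin K ⊕ Fin K) (e : Equiv.Perm (Fin n)) :
    (M.sampleLaw σ).map (reorder 𝒳 e) = M.sampleLaw (σ ∘ e) := by
  have h := Measure.map_infinitePi_infinitePi_of_inj (f := e)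
    (P := fun i => Sum.elim M.pre M.post (σ i)) e.injective
  rw [Measure.infinitePi_eq_pi, Measure.infinitePi_eq_pi] at h
  exact h

lemma mixture_map_reorder (s : Option (Fin K)) (e : Equiv.Perm (Fin n)) :
    (M.mixture s).map (reorder 𝒳 e) = M.mixture s := by
  have hm : Measurable (reorder 𝒳 e : (Fin n → 𝒳) → (Fin n → 𝒳)) := (reorder 𝒳 e).measurable
  rw [mixture, Measure.map_smul, ← Measure.mapₗ_apply_of_measurable hm, map_sum]
  congr 1
  simp_rw [Measure.mapₗ_apply_of_measurable hm, sampleLaw_map_reorder]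
  refine Finset.sum_bij (fun σ _ => σ ∘ e) (fun σ hσ => M.mem_labels_comp hσ e) ?_ ?_ ?_
  · intro a _ b _ h
    ext1 i
    simpa using congrFun h (e.symm i)
  · intro b hb
    exact ⟨b ∘ e.symm, M.mem_labels_comp hb e.symm, by ext1; simp⟩
  · intro _ _; rfl

lemma weightedMixture_map_reorder (β : Fin K → ℝ) (e : Equiv.Perm (Fin n)) :
    (M.weightedMixture β).map (reorder 𝒳 e) = M.weightedMixture β := by
  have hm : Measurable (reorder 𝒳 e : (Fin n → 𝒳) → (Fin n → 𝒳)) := (reorder 𝒳 e).measurable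
  rw [weightedMixture, ← Measure.mapₗ_apply_of_measurable hm, map_sum]
  simp_rw [Measure.mapₗ_apply_of_measurable hm, Measure.map_smul, mixture_map_reorder]

/-- The likelihood ratio of the weighted mixture. -/
def ratio (β : Fin K → ℝ) : (Fin n → 𝒳) → ℝ≥0∞ :=
  (M.weightedMixture β).rnDeriv (M.mixture none)

lemma measurable_ratio (β : Fin K → ℝ) : Measurable (M.ratio β) := Measure.measurable_rnDeriv _ _

/-- Both mixtures are invariant under reordering, and the density is unique up to null sets of the
pre-change mixture. Carrying the identity to another law therefore needs absolute continuity. -/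
lemma ratio_reorder {β : Fin K → ℝ} (hβ : β ∈ stdSimplex ℝ (Fin K)) (e : Equiv.Perm (Fin n)) :
    (fun x => M.ratio β (reorder 𝒳 e x)) =ᵐ[M.mixture none] M.ratio β := by
  have := M.isProbabilityMeasure_weightedMixture hβ
  have h := (reorder 𝒳 e).measurableEmbedding.rnDeriv_map (M.weightedMixture β) (M.mixture none)
  rwa [weightedMixture_map_reorder, mixture_map_reorder] at h

/-- The likelihood ratio of the weighted mixture has the same law under all labels of a type. -/
lemma map_ratio_sampleLaw {β : Fin K → ℝ} (hβ : β ∈ stdSimplex ℝ (Fin K)) {s : Option (Fin K)}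
    (hac : M.mixture s ≪ M.mixture none) {σ : Fin n → Fin K ⊕ Fin K} (hσ : σ ∈ M.labels s) :
    (M.sampleLaw σ).map (M.ratio β) = (M.mixture s).map (M.ratio β) := by
  have hm := M.measurable_ratio β
  have key : ∀ σ' ∈ M.labels s,
      (M.sampleLaw σ').map (M.ratio β) = (M.sampleLaw σ).map (M.ratio β) := by
    intro σ' hσ'
    obtain ⟨e, rfl⟩ := M.exists_perm_of_mem_labels hσ hσ'
    rw [← sampleLaw_map_reorder, Measure.map_map hm (reorder 𝒳 e).measurable]
    exact Measure.map_congr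
      (((M.sampleLaw_absolutelyContinuous hσ).trans hac).ae_le (M.ratio_reorder hβ e))
  rw [mixture, Measure.map_smul, ← Measure.mapₗ_apply_of_measurable hm, ←
    Measure.mapₗ_apply_of_measurable hm, map_sum]
  rw [Finset.sum_congr rfl (g := fun _ => (M.sampleLaw σ).map (M.ratio β))
    (by intro σ' hσ'; rw [Measure.mapₗ_apply_of_measurable hm]; exact key σ' hσ'),
    Measure.mapₗ_apply_of_measurable hm, Finset.sum_const, ← Nat.cast_smul_eq_nsmul ℝ≥0∞,
    smul_smul, ENNReal.inv_mul_cancel (M.card_labels_ne_zero s) (ENNReal.natCast_ne_top _),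
    one_smul]

/-- By equality of laws the mean is the one under the pre-change mixture, where a density never
integrates to more than the total mass. -/
lemma lintegral_ratio_sampleLaw_le {β : Fin K → ℝ} (hβ : β ∈ stdSimplex ℝ (Fin K))
    {σ : Fin n → Fin K ⊕ Fin K} (hσ : σ ∈ M.labels none) :
    ∫⁻ x, M.ratio β x ∂(M.sampleLaw σ) ≤ 1 := by
  have := M.isProbabilityMeasure_weightedMixture hβ
  have hm := M.measurable_ratio β
  have h1 := lintegral_map (μ := M.sampleLaw σ) measurable_id hm
  have h2 := lintegral_map (μ := M.mixture none) measurable_id hm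
  rw [M.map_ratio_sampleLaw hβ Measure.AbsolutelyContinuous.rfl hσ, h2] at h1
  simp only [id] at h1
  rw [← h1]
  exact Measure.lintegral_rnDeriv_le.trans (by simp)

lemma weightedMixture_single (k : Fin K) : M.weightedMixture (Pi.single k 1) = M.mixture (some k) := by
  classical
  rw [weightedMixture, Finset.sum_eq_single k]
  · simp
  · intro j _ hj; simp [hj]
  · simp

/-- Turns minimality over the simplex into minimality on the segment towards each vertex, the form
used by the first-order condition. -/
lemma weightedMixture_convexStep {β : Fin K → ℝ} (hβ : β ∈ stdSimplex ℝ (Fin K)) (k : Fin K)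
    {ε : ℝ} (h0 : 0 ≤ ε) (h1 : ε ≤ 1) :
    M.weightedMixture ((1 - ε) • β + ε • Pi.single k 1)
      = convexStep (M.weightedMixture β) (M.mixture (some k)) ε := by
  classical
  have h : ∀ j, ENNReal.ofReal (((1 - ε) • β + ε • (Pi.single k 1 : Fin K → ℝ)) j)
      = ENNReal.ofReal (1 - ε) * ENNReal.ofReal (β j)
        + ENNReal.ofReal ε * ENNReal.ofReal ((Pi.single k 1 : Fin K → ℝ) j) := by
    intro j
    have hs : 0 ≤ (Pi.single k 1 : Fin K → ℝ) j := by
      by_cases hj : j = k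
      · subst hj; simp
      · simp [hj]
    rw [Pi.add_apply, Pi.smul_apply, Pi.smul_apply, smul_eq_mul, smul_eq_mul,
      ENNReal.ofReal_add (mul_nonneg (by linarith) (hβ.1 j)) (mul_nonneg h0 hs),
      ENNReal.ofReal_mul (by linarith), ENNReal.ofReal_mul h0]
  rw [convexStep, ← weightedMixture_single]
  simp only [weightedMixture, h, add_smul, Finset.sum_add_distrib, Finset.smul_sum, smul_smul]

section Optimal

variable (hfin : ∀ k, InformationTheory.klDiv (M.mixture (some k)) (M.mixture none) ≠ ⊤)
  {β : Fin K → ℝ} (hβ : M.IsOptimalWeight β)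

include hfin

lemma mixture_absolutelyContinuous (s : Option (Fin K)) : M.mixture s ≪ M.mixture none := by
  cases s with
  | none => exact Measure.AbsolutelyContinuous.rfl
  | some k => exact (InformationTheory.klDiv_ne_top_iff.1 (hfin k)).1

include hβ

lemma weightedDiv_ne_top : M.weightedDiv β ≠ ⊤ := by
  -- Without types the weights could not sum to 1.
  obtain ⟨k⟩ : Nonempty (Fin K) := by
    by_contra h
    rw [not_nonempty_iff] at h
    have := hβ.1.2
    simp at this
  have h := hβ.2 (single_mem_stdSimplex ℝ k)
  refine ne_top_of_le_ne_top (hfin k) (le_trans h ?_)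
  rw [weightedDiv, weightedMixture_single]

lemma weightedMixture_absolutelyContinuous : M.weightedMixture β ≪ M.mixture none :=
  (InformationTheory.klDiv_ne_top_iff.1 (M.weightedDiv_ne_top hfin hβ)).1

lemma integrable_log_ratio :
    Integrable (fun x => Real.log (M.ratio β x).toReal) (M.weightedMixture β) :=
  (InformationTheory.klDiv_ne_top_iff.1 (M.weightedDiv_ne_top hfin hβ)).2

lemma integral_log_ratio :
    ∫ x, Real.log (M.ratio β x).toReal ∂(M.weightedMixture β) = (M.weightedDiv β).toReal := by
  have := M.isProbabilityMeasure_weightedMixture hβ.1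
  exact (InformationTheory.toReal_klDiv_of_measure_eq
    (M.weightedMixture_absolutelyContinuous hfin hβ) (by simp)).symm

/-- The least favourable weight makes every type at least as easy to detect as the mixture: this is
the first-order condition in the direction of vertex `k`. -/
lemma log_ratio_mixture (k : Fin K) :
    (∀ᵐ x ∂(M.mixture (some k)), 0 < (M.ratio β x).toReal) ∧
    Integrable (fun x => Real.log (M.ratio β x).toReal) (M.mixture (some k)) ∧
    (M.weightedDiv β).toReal ≤ ∫ x, Real.log (M.ratio β x).toReal ∂(M.mixture (some k)) := by
  have := M.isProbabilityMeasure_weightedMixture hβ.1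
  have h := integral_llr_le_of_klDiv_minimal (M.weightedMixture_absolutelyContinuous hfin hβ)
    (M.mixture_absolutelyContinuous hfin (some k)) (M.integrable_log_ratio hfin hβ)
    (InformationTheory.klDiv_ne_top_iff.1 (hfin k)).2 (fun ε h0 h1 => by
      rw [← M.weightedMixture_convexStep hβ.1 k h0.le h1.le]
      exact hβ.2 (convex_stdSimplex ℝ (Fin K) hβ.1 (single_mem_stdSimplex ℝ k)
        (by linarith) h0.le (by ring)))
  rw [← M.integral_log_ratio hfin hβ]
  exact h

/-- Under every post-change label the log-likelihood ratio has at least the minimal divergence as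
its mean, also after truncation from above, up to an arbitrarily small loss. -/
lemma exists_truncation {δ : ℝ} (hδ : 0 < δ) : ∃ c : ℝ, 0 ≤ c ∧
    ∀ k, ∀ σ ∈ M.labels (some k),
      (∀ᵐ x ∂(M.sampleLaw σ), 0 < M.ratio β x ∧ M.ratio β x < ⊤) ∧
      Integrable (fun x => min (Real.log (M.ratio β x).toReal) c) (M.sampleLaw σ) ∧
      (M.weightedDiv β).toReal - δ
        ≤ ∫ x, min (Real.log (M.ratio β x).toReal) c ∂(M.sampleLaw σ) := by
  have := M.isProbabilityMeasure_weightedMixture hβ.1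
  have hm := M.measurable_ratio β
  have hlm : Measurable fun x => Real.log (M.ratio β x).toReal :=
    Real.measurable_log.comp hm.ennreal_toReal
  have htrunc : ∀ (c : ℝ) (k : Fin K), 0 ≤ c → Integrable
      (fun x => min (Real.log (M.ratio β x).toReal) c) (M.mixture (some k)) := by
    intro c k hc
    refine (M.log_ratio_mixture hfin hβ k).2.1.mono (hlm.min measurable_const).aestronglyMeasurable
      (ae_of_all _ fun x => ?_)
    rw [Real.norm_eq_abs, Real.norm_eq_abs]
    rcases le_total (Real.log (M.ratio β x).toReal) c with h | h
    · rw [min_eq_left h]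
    · rw [min_eq_right h, abs_of_nonneg hc, abs_of_nonneg (hc.trans h)]; exact h
  have hc : ∀ k : Fin K, ∃ N : ℕ, ∀ j ≥ N, (M.weightedDiv β).toReal - δ
      ≤ ∫ x, min (Real.log (M.ratio β x).toReal) (j : ℝ) ∂(M.mixture (some k)) := by
    intro k
    obtain ⟨-, h2, h3⟩ := M.log_ratio_mixture hfin hβ k
    have ht : Tendsto (fun j : ℕ => ∫ x, min (Real.log (M.ratio β x).toReal) (j : ℝ)
        ∂(M.mixture (some k))) atTop
        (𝓝 (∫ x, Real.log (M.ratio β x).toReal ∂(M.mixture (some k)))) := by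
      refine tendsto_integral_of_dominated_convergence
        (fun x => ‖Real.log (M.ratio β x).toReal‖)
        (fun j => (hlm.min measurable_const).aestronglyMeasurable) h2.norm ?_ ?_
      · intro j
        refine ae_of_all _ fun x => ?_
        rw [Real.norm_eq_abs, Real.norm_eq_abs]
        have hj : (0 : ℝ) ≤ j := Nat.cast_nonneg j
        rcases le_total (Real.log (M.ratio β x).toReal) j with h | h
        · rw [min_eq_left h]
        · rw [min_eq_right h, abs_of_nonneg hj, abs_of_nonneg (hj.trans h)]; exact h
      · refine ae_of_all _ fun x => tendsto_const_nhds.congr' ?_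
        filter_upwards [tendsto_natCast_atTop_atTop.eventually_ge_atTop
          (Real.log (M.ratio β x).toReal)] with j hj
        rw [min_eq_left hj]
    exact eventually_atTop.1 (ht.eventually_const_le (by linarith))
  choose N hN using hc
  obtain ⟨c, hcN⟩ : ∃ c : ℕ, ∀ k, N k ≤ c :=
    ⟨Finset.univ.sup N, fun k => Finset.le_sup (Finset.mem_univ k)⟩
  refine ⟨c, Nat.cast_nonneg c, fun k σ hσ => ?_⟩
  have hmap := M.map_ratio_sampleLaw hβ.1 (M.mixture_absolutelyContinuous hfin (some k)) hσ
  have hφ : Measurable fun r : ℝ≥0∞ => min (Real.log r.toReal) (c : ℝ) :=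
    (Real.measurable_log.comp ENNReal.measurable_toReal).min measurable_const
  refine ⟨?_, ?_, ?_⟩
  · have h1 := (M.log_ratio_mixture hfin hβ k).1
    have h2 : ∀ᵐ x ∂(M.mixture (some k)), 0 < M.ratio β x ∧ M.ratio β x < ⊤ := by
      filter_upwards [h1] with x hx
      exact ENNReal.toReal_pos_iff.1 hx
    exact (M.sampleLaw_absolutelyContinuous hσ).ae_le h2
  · have h := htrunc c k (Nat.cast_nonneg c)
    have e := fun (ρ : Measure (Fin n → 𝒳)) =>
      integrable_map_measure (μ := ρ) (f := M.ratio β) hφ.aestronglyMeasurable hm.aemeasurable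
    exact (e _).1 (by rw [hmap]; exact (e _).2 h)
  · have e := fun (ρ : Measure (Fin n → 𝒳)) =>
      integral_map (μ := ρ) (φ := M.ratio β) hm.aemeasurable
        (f := fun r : ℝ≥0∞ => min (Real.log r.toReal) (c : ℝ)) hφ.aestronglyMeasurable
    rw [← e, hmap, e]
    exact hN k c (hcN k)

end Optimal

end SensorNetwork

/-! ### Passing from individual labels to mixtures -/

section Delay

variable {E : Type*} [MeasurableSpace E] {τ : (ℕ → E) → ℕ∞}

lemma measurable_delay (hτ : ∀ t : ℕ, MeasurableSet[pastAlgebra E t] {ω | τ ω ≤ t}) (v : ℕ) :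
    Measurable fun ω => ((τ ω - (v : ℕ∞) : ℕ∞) : ℝ≥0∞) := by
  simp_rw [delay_eq_tsum_indicator]
  exact Measurable.tsum fun m => measurable_one.indicator
    (pastAlgebra_le _ _ (measurableSet_lt_of_stopping hτ _))

/-- An inequality between integrals that holds for all admissible selections of the component laws
passes to the product of the mixed laws. -/
lemma lintegral_mono_of_mixture {Λ : Type*} [MeasurableSpace Λ] {κ : Λ → Measure E}
    [∀ a, IsProbabilityMeasure (κ a)] (hκ : Measurable κ)
    (w : ℕ → Measure Λ) [∀ t, IsProbabilityMeasure (w t)] {p : ℕ → Λ → Prop}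
    (hp : ∀ t, ∀ᵐ a ∂(w t), p t a) (μ : ℕ → Measure E) [∀ t, IsProbabilityMeasure (μ t)]
    (hμ : ∀ t, μ t = (w t).bind κ) {f g : (ℕ → E) → ℝ≥0∞} (hf : Measurable f) (hg : Measurable g)
    (h : ∀ a : ℕ → Λ, (∀ t, p t (a t)) →
      ∫⁻ ω, f ω ∂(Measure.infinitePi fun t => κ (a t))
        ≤ ∫⁻ ω, g ω ∂(Measure.infinitePi fun t => κ (a t))) :
    ∫⁻ ω, f ω ∂(Measure.infinitePi μ) ≤ ∫⁻ ω, g ω ∂(Measure.infinitePi μ) := by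
  have hm := measurable_infinitePi (κ := fun _ : ℕ => κ) fun _ => hκ
  rw [← infinitePi_bind μ (κ := fun _ => κ) (fun _ => hκ) w hμ,
    Measure.lintegral_bind hm.aemeasurable hf.aemeasurable,
    Measure.lintegral_bind hm.aemeasurable hg.aemeasurable]
  refine lintegral_mono_ae ?_
  filter_upwards [ae_all_iff.2 fun t => ae_eval w (hp t)] with a ha using h a ha

end Delay

namespace SensorNetwork

variable {𝒳 : Type*} [MeasurableSpace 𝒳] {K n : ℕ} (M : SensorNetwork 𝒳 K n)

instance isProbabilityMeasure_seqLaw (Ω : ℕ → Fin n → Fin K ⊕ Fin K) :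
    IsProbabilityMeasure (M.seqLaw Ω) := by
  unfold seqLaw; infer_instance

/-! ### Random labels whose mean laws are the mixtures -/

section Labels

/-- Label functions as a discrete measurable space. -/
structure LabelSpace (K n : ℕ) where
  label : Fin n → Fin K ⊕ Fin K

instance : MeasurableSpace (LabelSpace K n) := ⊤

/-- The uniform law on the admissible labels of a type. -/
def labelLaw (s : Option (Fin K)) : Measure (LabelSpace K n) :=
  ((M.labels s).card : ℝ≥0∞)⁻¹ • ∑ σ ∈ M.labels s, Measure.dirac (LabelSpace.mk σ)

/-- The law of a uniform label of a random type with distribution `β`. -/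
def weightedLabelLaw (β : Fin K → ℝ) : Measure (LabelSpace K n) :=
  ∑ k, ENNReal.ofReal (β k) • M.labelLaw (some k)

/-- `sampleLaw` as a map on the space of labels. -/
def labelKernel (σ : LabelSpace K n) : Measure (Fin n → 𝒳) := M.sampleLaw σ.label

instance (σ : LabelSpace K n) : IsProbabilityMeasure (M.labelKernel σ) :=
  M.isProbabilityMeasure_sampleLaw σ.label

lemma measurable_labelKernel : Measurable M.labelKernel := measurable_from_top

instance (s : Option (Fin K)) : IsProbabilityMeasure (M.labelLaw s) := by
  constructor
  simp only [labelLaw, Measure.coe_smul, Pi.smul_apply, Measure.coe_finsetSum, Finset.sum_apply,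
    measure_univ, Finset.sum_const, nsmul_eq_mul, mul_one, smul_eq_mul]
  exact ENNReal.inv_mul_cancel (M.card_labels_ne_zero s) (ENNReal.natCast_ne_top _)

lemma isProbabilityMeasure_weightedLabelLaw {β : Fin K → ℝ} (hβ : β ∈ stdSimplex ℝ (Fin K)) :
    IsProbabilityMeasure (M.weightedLabelLaw β) := by
  constructor
  simp only [weightedLabelLaw, Measure.coe_smul, Pi.smul_apply, Measure.coe_finsetSum,
    Finset.sum_apply, measure_univ, mul_one, smul_eq_mul]
  rw [← ENNReal.ofReal_sum_of_nonneg fun k _ => hβ.1 k, hβ.2, ENNReal.ofReal_one]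

lemma lintegral_labelLaw (s : Option (Fin K)) (f : LabelSpace K n → ℝ≥0∞) :
    ∫⁻ σ, f σ ∂(M.labelLaw s) = ((M.labels s).card : ℝ≥0∞)⁻¹ * ∑ σ ∈ M.labels s, f ⟨σ⟩ := by
  rw [labelLaw, lintegral_smul_measure, lintegral_finsetSum_measure, smul_eq_mul]
  congr 1
  exact Finset.sum_congr rfl fun σ _ => lintegral_dirac' _ measurable_from_top

lemma labelLaw_bind (s : Option (Fin K)) : M.mixture s = (M.labelLaw s).bind M.labelKernel := by
  ext A hA
  rw [Measure.bind_apply hA M.measurable_labelKernel.aemeasurable, lintegral_labelLaw]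
  simp [mixture, labelKernel]

lemma weightedLabelLaw_bind (β : Fin K → ℝ) :
    M.weightedMixture β = (M.weightedLabelLaw β).bind M.labelKernel := by
  ext A hA
  rw [Measure.bind_apply hA M.measurable_labelKernel.aemeasurable, weightedLabelLaw,
    lintegral_finsetSum_measure]
  simp only [weightedMixture, Measure.coe_finsetSum, Finset.sum_apply, lintegral_smul_measure]
  refine Finset.sum_congr rfl fun k _ => ?_
  rw [labelLaw_bind, Measure.smul_apply,
    Measure.bind_apply hA M.measurable_labelKernel.aemeasurable]

lemma ae_labelLaw (s : Option (Fin K)) : ∀ᵐ σ ∂(M.labelLaw s), σ.label ∈ M.labels s := by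
  rw [ae_iff, ← lintegral_indicator_one (MeasurableSpace.measurableSet_top),
    lintegral_labelLaw, mul_eq_zero]
  right
  refine Finset.sum_eq_zero fun σ hσ => ?_
  simp [hσ]

lemma ae_weightedLabelLaw (β : Fin K → ℝ) :
    ∀ᵐ σ ∂(M.weightedLabelLaw β), ∃ k, σ.label ∈ M.labels (some k) := by
  rw [ae_iff, weightedLabelLaw, Measure.coe_finsetSum, Finset.sum_apply]
  refine Finset.sum_eq_zero fun k _ => ?_
  rw [Measure.smul_apply, smul_eq_mul, mul_eq_zero]
  right
  have h : ∀ᵐ σ ∂(M.labelLaw (some k)), ∃ k, σ.label ∈ M.labels (some k) := by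
    filter_upwards [M.ae_labelLaw (some k)] with σ hσ using ⟨k, hσ⟩
  exact ae_iff.1 h

end Labels

/-! ### The worst-case delay in integrated form -/

section Criteria

variable {τ : ObsSeq 𝒳 n → ℕ∞}

/-- A uniform bound on the conditional mean delay in integrated form bounds `wadd`. -/
lemma wadd_le_of_setLIntegral_le {C : ℝ≥0∞}
    (h : ∀ (v : ℕ) (S : ℕ → Option (Fin K)) (_ : IsTrajectory (v + 1) S)
      (Ω : ℕ → Fin n → Fin K ⊕ Fin K) (_ : M.IsLabelSeq S Ω) (A : Set (ObsSeq 𝒳 n))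
      (_ : MeasurableSet[pastAlgebra (Fin n → 𝒳) v] A),
      ∫⁻ ω in A, ((τ ω - ((v + 1 : ℕ) : ℕ∞) : ℕ∞) : ℝ≥0∞) ∂(M.seqLaw Ω) ≤ C * M.seqLaw Ω A) :
    M.wadd τ ≤ C := by
  refine iSup_le fun ν => iSup_le fun hν => iSup_le fun S => iSup_le fun hS => iSup_le fun Ω =>
    iSup_le fun hΩ => ?_
  -- Times start at 1 and coordinates at 0: for the change-point `v + 1` the first affected vector
  -- has index `v`, and the past consists of the indices below `v`.
  obtain ⟨v, rfl⟩ : ∃ v, ν = v + 1 := ⟨ν - 1, by omega⟩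
  rw [Nat.add_sub_cancel]
  have hm : obsFiltration 𝒳 n v ≤ (inferInstance : MeasurableSpace (ObsSeq 𝒳 n)) :=
    (obsFiltration 𝒳 n).le v
  refine essSup_le_of_ae_le _ (ae_of_ae_trim hm ?_)
  refine @ae_le_of_forall_setLIntegral_le_of_sigmaFinite _ (obsFiltration 𝒳 n v)
    ((M.seqLaw Ω).trim hm) _ _ _ (measurable_condLExp _ _ _) fun A hA _ => ?_
  rw [setLIntegral_condLExp_trim hm _ _ hA, lintegral_const, Measure.restrict_apply .univ,
    Set.univ_inter, trim_measurableSet_eq hm hA]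
  exact h v S hS Ω hΩ A hA

/-- Unlike conditional expectations and essential suprema, this inequality is linear in the law, so
it can be averaged over labels. -/
lemma setLIntegral_le_of_wadd_le {C : ℝ≥0∞} (h : M.wadd τ ≤ C) {v : ℕ}
    {S : ℕ → Option (Fin K)} (hS : IsTrajectory (v + 1) S)
    {Ω : ℕ → Fin n → Fin K ⊕ Fin K} (hΩ : M.IsLabelSeq S Ω) {A : Set (ObsSeq 𝒳 n)}
    (hA : MeasurableSet[pastAlgebra (Fin n → 𝒳) v] A) :
    ∫⁻ ω in A, ((τ ω - ((v + 1 : ℕ) : ℕ∞) : ℕ∞) : ℝ≥0∞) ∂(M.seqLaw Ω) ≤ C * M.seqLaw Ω A := by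
  have hm : obsFiltration 𝒳 n v ≤ (inferInstance : MeasurableSpace (ObsSeq 𝒳 n)) :=
    (obsFiltration 𝒳 n).le v
  have h1 : essSup (condLExp (obsFiltration 𝒳 n v) (M.seqLaw Ω)
      (fun ω => ((τ ω - ((v + 1 : ℕ) : ℕ∞) : ℕ∞) : ℝ≥0∞))) (M.seqLaw Ω) ≤ C := by
    refine le_trans ?_ h
    unfold wadd
    exact le_iSup_of_le (v + 1) (le_iSup_of_le (by omega) (le_iSup_of_le S (le_iSup_of_le hS
      (le_iSup_of_le Ω (le_iSup_of_le hΩ le_rfl)))))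
  rw [← setLIntegral_condLExp hm _ _ hA, ← setLIntegral_const]
  refine lintegral_mono_ae (ae_restrict_of_ae ?_)
  filter_upwards [ENNReal.ae_le_essSup (condLExp (obsFiltration 𝒳 n v) (M.seqLaw Ω)
      (fun ω => ((τ ω - ((v + 1 : ℕ) : ℕ∞) : ℕ∞) : ℝ≥0∞)))] with ω hω using hω.trans h1

end Criteria

/-! ### Running length and delay of the mixture CuSum test -/

section Cusum

lemma sum_logRatio (β : Fin K → ℝ) (s : Finset ℕ) (ω : ObsSeq 𝒳 n) :
    ∑ i ∈ s, M.logRatio β (obs ω i) = ENNReal.log (∏ i ∈ s, M.ratio β (obs ω i)) := by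
  classical
  induction s using Finset.induction_on with
  | empty => simp
  | insert a s ha ih =>
    rw [Finset.sum_insert ha, Finset.prod_insert ha, ENNReal.log_mul_add, ih]; rfl

/-- Exponentiating replaces sums in `EReal` by products in `ℝ≥0∞`, and a finite supremum is
attained. Here `j = t` is the empty product, the term `j = t + 1` of the statistic. -/
lemma log_le_cusumStat_iff (β : Fin K → ℝ) {γ : ℝ} (hγ : 0 < γ) (t : ℕ) (ω : ObsSeq 𝒳 n) :
    ((Real.log γ : ℝ) : EReal) ≤ M.cusumStat β t ω ↔
      ∃ j ≤ t, ENNReal.ofReal γ ≤ ∏ i ∈ Finset.Ico j t, M.ratio β (ω i) := by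
  have hshift : ∀ j, ∏ i ∈ Finset.Icc (j + 1) t, M.ratio β (obs ω i)
      = ∏ i ∈ Finset.Ico j t, M.ratio β (ω i) := by
    intro j
    rw [← Finset.Ico_add_one_right_eq_Icc, ← Finset.prod_Ico_add' _ j t 1]
    rfl
  rw [cusumStat, ← Finset.sup_eq_iSup, Finset.le_sup_iff (EReal.bot_lt_coe _)]
  constructor
  · rintro ⟨j, hj, h⟩
    rw [Finset.mem_Icc] at hj
    obtain ⟨j, rfl⟩ : ∃ i, j = i + 1 := ⟨j - 1, by omega⟩
    refine ⟨j, by omega, ?_⟩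
    rwa [sum_logRatio, hshift, ← ENNReal.log_ofReal_of_pos hγ, ENNReal.log_le_log_iff] at h
  · rintro ⟨j, hj, h⟩
    refine ⟨j + 1, Finset.mem_Icc.2 ⟨by omega, by omega⟩, ?_⟩
    rwa [sum_logRatio, hshift, ← ENNReal.log_ofReal_of_pos hγ, ENNReal.log_le_log_iff]

lemma cusumTime_le_iff (β : Fin K → ℝ) (b : ℝ) (ω : ObsSeq 𝒳 n) (t : ℕ) :
    M.cusumTime β b ω ≤ t ↔ ∃ s ≤ t, 1 ≤ s ∧ (b : EReal) ≤ M.cusumStat β s ω := by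
  constructor
  · intro h
    by_contra hcon
    push Not at hcon
    have : ((t + 1 : ℕ) : ℕ∞) ≤ M.cusumTime β b ω := by
      refine le_iInf₂ fun s hs => ?_
      by_contra hlt
      have hst : s ≤ t := by
        have : (s : ℕ∞) < ((t + 1 : ℕ) : ℕ∞) := not_le.1 hlt
        have : s < t + 1 := by exact_mod_cast this
        omega
      exact absurd hs.2 (not_le.2 (hcon s hst hs.1))
    have h2 := this.trans h
    have : t + 1 ≤ t := by exact_mod_cast h2
    omega
  · rintro ⟨s, hst, hs⟩
    exact (iInf₂_le s hs).trans (by exact_mod_cast hst)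

lemma one_le_cusumTime (β : Fin K → ℝ) (b : ℝ) (ω : ObsSeq 𝒳 n) : 1 ≤ M.cusumTime β b ω :=
  le_iInf₂ fun s hs => by exact_mod_cast hs.1

lemma measurableSet_cusumTime_le (β : Fin K → ℝ) {γ : ℝ} (hγ : 0 < γ) (t : ℕ) :
    MeasurableSet[pastAlgebra (Fin n → 𝒳) t] {ω | M.cusumTime β (Real.log γ) ω ≤ t} := by
  have : {ω | M.cusumTime β (Real.log γ) ω ≤ t} = ⋃ (s : ℕ) (_ : s ≤ t ∧ 1 ≤ s) (j : ℕ)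
      (_ : j ≤ s), {ω | ENNReal.ofReal γ ≤ ∏ i ∈ Finset.Ico j s, M.ratio β (ω i)} := by
    ext ω
    simp only [Set.mem_ofPred_eq, cusumTime_le_iff, M.log_le_cusumStat_iff β hγ, Set.mem_iUnion,
      exists_prop, and_assoc]
  rw [this]
  refine MeasurableSet.iUnion fun s => MeasurableSet.iUnion fun hs => MeasurableSet.iUnion fun j =>
    MeasurableSet.iUnion fun hj => ?_
  suffices Measurable[pastAlgebra (Fin n → 𝒳) t]
      (fun ω : ObsSeq 𝒳 n => ∏ i ∈ Finset.Ico j s, M.ratio β (ω i)) from this measurableSet_Ici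
  refine Finset.measurable_fun_prod _ fun i hi => ?_
  have := (Finset.mem_Ico.1 hi).2
  exact (M.measurable_ratio β).comp (measurable_eval_past (by omega))

lemma cusumTime_mem_feasible {β : Fin K → ℝ} (hβ : β ∈ stdSimplex ℝ (Fin K)) {γ : ℝ}
    (hγ : 0 < γ) : M.cusumTime β (Real.log γ) ∈ M.feasible γ := by
  refine ⟨fun t => M.measurableSet_cusumTime_le β hγ t, le_iInf₂ fun Ω hΩ => ?_⟩
  -- For `γ ≤ 1` the empty product may cause the stop, but every stopping time with values at least
  -- 1 is then feasible.
  rcases le_or_gt γ 1 with h1 | h1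
  · calc ENNReal.ofReal γ ≤ 1 := ENNReal.ofReal_le_one.2 h1
      _ = ∫⁻ _, 1 ∂(M.seqLaw Ω) := by simp
      _ ≤ _ := lintegral_mono fun ω => by
        have := M.one_le_cusumTime β (Real.log γ) ω
        simpa using ENat.toENNReal_le.2 this
  · refine le_lintegral_of_le_shiryaevRoberts _ (M.measurable_ratio β)
      (fun t => M.lintegral_ratio_sampleLaw_le hβ (hΩ (t + 1) (by omega)))
      (M.measurableSet_cusumTime_le β hγ) (M.one_le_cusumTime β _) ?_
    intro ω t ht
    obtain ⟨s, hst, hs1, hs⟩ := (M.cusumTime_le_iff β _ ω t).1 ht.le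
    have hts : t ≤ s := by
      have : M.cusumTime β (Real.log γ) ω ≤ s :=
        (M.cusumTime_le_iff β _ ω s).2 ⟨s, le_rfl, hs1, hs⟩
      rw [ht] at this
      exact_mod_cast this
    obtain rfl : s = t := le_antisymm hst hts
    obtain ⟨j, hj, hprod⟩ := (M.log_le_cusumStat_iff β hγ s ω).1 hs
    rcases hj.lt_or_eq with hj | rfl
    · exact hprod.trans (prod_le_shiryaevRoberts _ _ hj)
    · simp only [Finset.Ico_self, Finset.prod_empty, ENNReal.ofReal_le_one] at hprod
      linarith

omit [MeasurableSpace 𝒳] in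
lemma ofReal_exp_sum_log {L : (Fin n → 𝒳) → ℝ≥0∞} {k v : ℕ} {ω : ObsSeq 𝒳 n}
    (hω : ∀ t, v ≤ t → 0 < L (ω t) ∧ L (ω t) < ⊤) :
    ENNReal.ofReal (Real.exp (∑ i ∈ Finset.range k, Real.log (L (ω (v + i))).toReal))
      = ∏ i ∈ Finset.range k, L (ω (v + i)) := by
  rw [Real.exp_sum, ENNReal.ofReal_prod_of_nonneg fun _ _ => (Real.exp_pos _).le]
  refine Finset.prod_congr rfl fun i _ => ?_
  obtain ⟨h1, h2⟩ := hω (v + i) (by omega)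
  rw [Real.exp_log (ENNReal.toReal_pos h1.ne' h2.ne), ENNReal.ofReal_toReal h2.ne]

/-- Upper bound for the worst-case delay of the mixture CuSum test. -/
lemma exists_wadd_cusumTime_le
    (hfin : ∀ k, InformationTheory.klDiv (M.mixture (some k)) (M.mixture none) ≠ ⊤)
    {β : Fin K → ℝ} (hβ : M.IsOptimalWeight β) {δ : ℝ} (hδ : 0 < δ)
    (hδI : δ < (M.weightedDiv β).toReal) :
    ∃ c : ℝ, 0 ≤ c ∧ ∀ γ : ℝ, 1 < γ → M.wadd (M.cusumTime β (Real.log γ))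
      ≤ ENNReal.ofReal ((Real.log γ + c) / ((M.weightedDiv β).toReal - δ)) := by
  obtain ⟨c, hc0, hc⟩ := M.exists_truncation hfin hβ hδ
  refine ⟨c, hc0, fun γ hγ => M.wadd_le_of_setLIntegral_le fun v S hS Ω hΩ A hA => ?_⟩
  have hγ0 : 0 < γ := by linarith
  have hlab : ∀ t, v ≤ t → ∃ k, Ω (t + 1) ∈ M.labels (some k) := by
    intro t ht
    have h1 := hΩ (t + 1) (by omega)
    cases hk : S (t + 1) with
    | none =>
      have := (hS (t + 1) (by omega)).1 hk
      omega
    | some k => rw [hk] at h1; exact ⟨k, h1⟩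
  have hgood : ∀ᵐ ω ∂(M.seqLaw Ω), ∀ t, v ≤ t →
      0 < M.ratio β (ω t) ∧ M.ratio β (ω t) < ⊤ := by
    rw [ae_all_iff]; intro t
    by_cases ht : v ≤ t
    · obtain ⟨k, hk⟩ := hlab t ht
      filter_upwards [ae_eval (fun s => M.sampleLaw (Ω (s + 1))) (hc k _ hk).1] with ω hω _ using hω
    · exact ae_of_all _ fun ω h => absurd h ht
  let y : (Fin n → 𝒳) → ℝ := fun x => min (Real.log (M.ratio β x).toReal) c
  have hy : Measurable y := (Real.measurable_log.comp
    (M.measurable_ratio β).ennreal_toReal).min measurable_const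
  -- While the CuSum has not stopped, the product started at the true change `v` is below `γ`; hence
  -- so is its logarithm below `log γ`, and a fortiori the walk with truncated increments.
  have hsub : ∀ m : ℕ, M.seqLaw Ω (A ∩ {ω | ((v + 1 + m : ℕ) : ℕ∞) <
      M.cusumTime β (Real.log γ) ω}) ≤ M.seqLaw Ω (belowSet y (Real.log γ) v A m) := by
    intro m
    refine measure_mono_ae ?_
    filter_upwards [hgood] with ω hω
    rintro ⟨hωA, hωT⟩
    refine ⟨hωA, fun j hj1 hjm => ?_⟩
    by_contra hcon
    push Not at hcon
    have hωT' : ((v + 1 + m : ℕ) : ℕ∞) < M.cusumTime β (Real.log γ) ω := hωT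
    refine absurd hωT' (not_lt.2 ?_)
    refine (M.cusumTime_le_iff β _ ω _).2 ⟨v + j, by omega, by omega, ?_⟩
    rw [M.log_le_cusumStat_iff β hγ0]
    refine ⟨v, by omega, ?_⟩
    rw [Finset.prod_Ico_eq_prod_range, Nat.add_sub_cancel_left, ← ofReal_exp_sum_log hω]
    refine ENNReal.ofReal_le_ofReal ?_
    rw [← Real.log_le_iff_le_exp hγ0]
    exact hcon.trans (Finset.sum_le_sum fun i _ => min_le_left _ _)
  rw [setLIntegral_delay_eq_tsum (M.measurableSet_cusumTime_le β hγ0)]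
  refine (ENNReal.tsum_le_tsum hsub).trans ?_
  refine tsum_belowSet_le (fun s => M.sampleLaw (Ω (s + 1))) hy (Real.log_nonneg hγ.le) hc0
    (by linarith) (fun x => min_le_right _ _) ?_ ?_ hA
  · intro t ht
    obtain ⟨k, hk⟩ := hlab t ht
    exact (hc k _ hk).2.1
  · intro t ht
    obtain ⟨k, hk⟩ := hlab t ht
    exact (hc k _ hk).2.2

end Cusum

/-! ### Reduction of a feasible stopping time to the simple hypotheses -/

section LowerBound

/-- Lower bound for the worst-case delay of all feasible stopping times. -/
lemma le_wadd_of_feasible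
    (hfin : ∀ k, InformationTheory.klDiv (M.mixture (some k)) (M.mixture none) ≠ ⊤)
    {β : Fin K → ℝ} (hβ : M.IsOptimalWeight β) {γ W : ℝ} (hW0 : 0 ≤ W) {τ : ObsSeq 𝒳 n → ℕ∞}
    (hτ : τ ∈ M.feasible γ) (hW : M.wadd τ ≤ ENNReal.ofReal W) {m : ℕ} (hm : 1 ≤ m)
    (hmγ : (m : ℝ) ≤ γ) :
    Real.log (γ / m) * (1 - W / m) - (M.weightedDiv β).toReal * (W + 1) ≤ 1 := by
  have hprob := M.isProbabilityMeasure_weightedMixture hβ.1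
  have hlprob := M.isProbabilityMeasure_weightedLabelLaw hβ.1
  have hac := M.weightedMixture_absolutelyContinuous hfin hβ
  have hst : ∀ t : ℕ, MeasurableSet[pastAlgebra (Fin n → 𝒳) t] {ω | τ ω ≤ t} := hτ.1
  have hlt := measurableSet_lt_of_stopping hst
  rw [← M.integral_log_ratio hfin hβ]
  refine delay_lower_bound (P₀ := M.mixture none) (M.measurable_ratio β)
    (Measure.withDensity_rnDeriv_eq _ _ hac).symm ?_ (M.integrable_log_ratio hfin hβ) ?_ hst hm
    hmγ ?_ ?_
  · filter_upwards [Measure.rnDeriv_pos hac,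
      hac.ae_le (Measure.rnDeriv_lt_top (M.weightedMixture β) (M.mixture none))]
      with x h1 h2 using ⟨h1, h2⟩
  · rw [M.integral_log_ratio hfin hβ]; exact ENNReal.toReal_nonneg
  · have h := lintegral_mono_of_mixture M.measurable_labelKernel (fun _ : ℕ => M.labelLaw none)
      (p := fun _ σ => σ.label ∈ M.labels none) (fun _ => M.ae_labelLaw none)
      (fun _ : ℕ => M.mixture none) (fun _ => M.labelLaw_bind none)
      (f := fun _ => ENNReal.ofReal γ) (g := fun ω => (τ ω : ℝ≥0∞)) measurable_const
      (by simpa using measurable_delay hst 0) (fun a ha => by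
        rw [lintegral_const, measure_univ, mul_one]
        -- The label at time `t` is the coordinate `t - 1`; the value at `t = 0` enters no law.
        refine hτ.2.trans ((iInf₂_le (fun t => (a (t - 1)).label) fun t _ => ha (t - 1)).trans_eq ?_)
        rfl)
    rwa [lintegral_const, measure_univ, mul_one] at h
  · intro v N
    set Q := Measure.infinitePi (changeLaw (M.mixture none) (M.weightedMixture β) v)
    have hA := hlt v
    have hA' := pastAlgebra_le _ _ hA
    let w : ℕ → Measure (LabelSpace K n) := fun t =>
      if t < v then M.labelLaw none else M.weightedLabelLaw β
    have hw : ∀ t, IsProbabilityMeasure (w t) := fun t => by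
      simp only [w]; split_ifs <;> infer_instance
    -- Labels are independent, pre-change before `v` and of a `β`-random type from `v` on. The only
    -- past event needed is `v < τ`.
    have h := lintegral_mono_of_mixture M.measurable_labelKernel w
      (p := fun t σ => ∃ s : Option (Fin K), (s = none ↔ t < v) ∧ σ.label ∈ M.labels s) ?_
      (changeLaw (M.mixture none) (M.weightedMixture β) v) ?_
      (f := {ω | (v : ℕ∞) < τ ω}.indicator
        (fun ω => ((τ ω - ((v + 1 : ℕ) : ℕ∞) : ℕ∞) : ℝ≥0∞)))
      (g := {ω | (v : ℕ∞) < τ ω}.indicator (fun _ => ENNReal.ofReal W))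
      ((measurable_delay hst _).indicator hA') (measurable_const.indicator hA') ?_
    · rw [lintegral_indicator hA', lintegral_indicator hA', setLIntegral_const,
        setLIntegral_delay_eq_tsum hst] at h
      have h2 : ∑ i ∈ Finset.range N, Q {ω | ((v + 1 + i : ℕ) : ℕ∞) < τ ω}
          ≤ ENNReal.ofReal W * Q {ω | (v : ℕ∞) < τ ω} := by
        refine le_trans ?_ h
        refine le_trans (Finset.sum_le_sum fun i _ => measure_mono ?_) (ENNReal.sum_le_tsum _)
        intro ω hω
        have h3 : (v : ℕ∞) ≤ ((v + 1 + i : ℕ) : ℕ∞) := by exact_mod_cast (by omega)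
        exact ⟨h3.trans_lt hω, hω⟩
      have h4 := ENNReal.toReal_mono (by finiteness) h2
      rw [ENNReal.toReal_sum (by finiteness), ENNReal.toReal_mul, ENNReal.toReal_ofReal hW0] at h4
      exact h4
    · intro t
      by_cases ht : t < v
      · simp only [w, if_pos ht]
        filter_upwards [M.ae_labelLaw none] with σ hσ using ⟨none, by simp [ht], hσ⟩
      · simp only [w, if_neg ht]
        filter_upwards [M.ae_weightedLabelLaw β] with σ hσ
        obtain ⟨k, hk⟩ := hσ
        exact ⟨some k, by simp [ht], hk⟩
    · intro t
      simp only [w, changeLaw]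
      split_ifs
      · exact M.labelLaw_bind none
      · exact M.weightedLabelLaw_bind β
    · intro a ha
      -- The drawn types change from one time to the next; they form an admissible trajectory
      -- because trajectories are arbitrary.
      choose S hS using ha
      rw [lintegral_indicator hA', lintegral_indicator hA', setLIntegral_const]
      refine M.setLIntegral_le_of_wadd_le hW (S := fun t => S (t - 1)) (Ω := fun t => (a (t - 1)).label)
        ?_ ?_ hA
      · intro t ht
        rw [(hS (t - 1)).1]; omega
      · intro t _
        exact (hS (t - 1)).2

end LowerBound

end SensorNetwork

/-! ### Limits of the explicit bounds -/

section Asymptotics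

lemma tendsto_log_ceil_sq_div :
    Tendsto (fun x : ℝ => Real.log (⌈x ^ 2⌉₊ : ℝ) / x) atTop (𝓝 0) := by
  have h1 : Tendsto (fun x : ℝ => (Real.log 2 + 2 * Real.log x) / x) atTop (𝓝 0) := by
    have hl : Tendsto (fun x : ℝ => Real.log x / x) atTop (𝓝 0) :=
      Real.isLittleO_log_id_atTop.tendsto_div_nhds_zero
    have hc : Tendsto (fun x : ℝ => Real.log 2 / x) atTop (𝓝 0) :=
      tendsto_const_nhds.div_atTop tendsto_id
    have := hc.add (hl.const_mul 2)
    simp only [mul_zero, add_zero] at this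
    refine this.congr fun x => ?_
    ring
  refine tendsto_of_tendsto_of_tendsto_of_le_of_le' tendsto_const_nhds h1 ?_ ?_
  · filter_upwards [eventually_ge_atTop 1] with x hx
    have : (1 : ℝ) ≤ (⌈x ^ 2⌉₊ : ℝ) := le_trans (by nlinarith) (Nat.le_ceil (x ^ 2))
    exact div_nonneg (Real.log_nonneg this) (by linarith)
  · filter_upwards [eventually_ge_atTop 1] with x hx
    have h1 : (1 : ℝ) ≤ (⌈x ^ 2⌉₊ : ℝ) := le_trans (by nlinarith) (Nat.le_ceil (x ^ 2))
    have h2 : (⌈x ^ 2⌉₊ : ℝ) ≤ 2 * x ^ 2 := by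
      have := (Nat.ceil_lt_add_one (sq_nonneg x)).le
      nlinarith
    have h3 := Real.log_le_log (by linarith) h2
    rw [Real.log_mul (by norm_num) (by positivity), Real.log_pow] at h3
    push_cast at h3
    gcongr

lemma tendsto_div_ceil_sq :
    Tendsto (fun x : ℝ => x / (⌈x ^ 2⌉₊ : ℝ)) atTop (𝓝 0) := by
  refine tendsto_of_tendsto_of_tendsto_of_le_of_le' tendsto_const_nhds tendsto_inv_atTop_zero ?_ ?_
  · filter_upwards [eventually_ge_atTop 0] with x hx
    positivity
  · filter_upwards [eventually_gt_atTop 0] with x hx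
    have h1 := Nat.le_ceil (x ^ 2)
    rw [div_le_iff₀ (lt_of_lt_of_le (by positivity) h1)]
    calc x = x⁻¹ * x ^ 2 := by field_simp
      _ ≤ _ := by gcongr

/-- The lower bound on the delay with the window length `⌈x ^ 2⌉₊` is asymptotically `x / I`. -/
lemma tendsto_lower_bound {I : ℝ} (hI : 0 < I) :
    Tendsto (fun x : ℝ => (x - Real.log (⌈x ^ 2⌉₊ : ℝ) - I - 1)
      / (I + (x - Real.log (⌈x ^ 2⌉₊ : ℝ)) / (⌈x ^ 2⌉₊ : ℝ)) / x) atTop (𝓝 I⁻¹) := by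
  have hA := tendsto_log_ceil_sq_div
  have hB := tendsto_div_ceil_sq
  have hC : Tendsto (fun x : ℝ => (I + 1) / x) atTop (𝓝 0) :=
    tendsto_const_nhds.div_atTop tendsto_id
  have hone : Tendsto (fun _ : ℝ => (1 : ℝ)) atTop (𝓝 1) := tendsto_const_nhds
  have hnum := (hone.sub hA).sub hC
  have hden := (tendsto_const_nhds (x := I)).add (hB.mul (hone.sub hA))
  have := hnum.div hden (by simpa using hI.ne')
  simp only [sub_zero, mul_one, add_zero, one_div] at this
  refine this.congr' ?_
  filter_upwards [eventually_gt_atTop 0] with x hx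
  have hm : (0 : ℝ) < (⌈x ^ 2⌉₊ : ℝ) := lt_of_lt_of_le (by positivity) (Nat.le_ceil (x ^ 2))
  simp only [Pi.div_apply]
  have e1 : x / (⌈x ^ 2⌉₊ : ℝ) * (1 - Real.log (⌈x ^ 2⌉₊ : ℝ) / x)
      = (x - Real.log (⌈x ^ 2⌉₊ : ℝ)) / (⌈x ^ 2⌉₊ : ℝ) := by field_simp
  have e2 : 1 - Real.log (⌈x ^ 2⌉₊ : ℝ) / x - (I + 1) / x
      = (x - Real.log (⌈x ^ 2⌉₊ : ℝ) - I - 1) / x := by field_simp; ring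
  rw [e1, e2, div_right_comm]

lemma tendsto_upper_bound {d : ℝ} (c : ℝ) (hd : 0 < d) :
    Tendsto (fun x : ℝ => (x + c) / d / x) atTop (𝓝 d⁻¹) := by
  have hC : Tendsto (fun x : ℝ => c / x) atTop (𝓝 0) := tendsto_const_nhds.div_atTop tendsto_id
  have := ((tendsto_const_nhds (x := (1 : ℝ))).add hC).mul_const d⁻¹
  simp only [add_zero, one_mul] at this
  refine this.congr' ?_
  filter_upwards [eventually_gt_atTop 0] with x hx
  field_simp

end Asymptotics

/-! ### The optimal delay and the final asymptotics -/

namespace SensorNetwork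

variable {𝒳 : Type*} [MeasurableSpace 𝒳] {K n : ℕ} (M : SensorNetwork 𝒳 K n)

/-- The linear inequality of `le_wadd_of_feasible` solved for the delay; an infinite delay needs no
argument. -/
lemma le_optimalWadd
    (hfin : ∀ k, InformationTheory.klDiv (M.mixture (some k)) (M.mixture none) ≠ ⊤)
    {β : Fin K → ℝ} (hβ : M.IsOptimalWeight β) (hI : 0 < (M.weightedDiv β).toReal) {γ : ℝ} {m : ℕ}
    (hm : 1 ≤ m) (hmγ : (m : ℝ) ≤ γ) :
    ENNReal.ofReal ((Real.log γ - Real.log m - (M.weightedDiv β).toReal - 1)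
      / ((M.weightedDiv β).toReal + (Real.log γ - Real.log m) / m)) ≤ M.optimalWadd γ := by
  refine le_iInf₂ fun τ hτ => ?_
  by_cases htop : M.wadd τ = ⊤
  · rw [htop]; exact le_top
  have hm0 : (0 : ℝ) < m := by exact_mod_cast hm
  have h := M.le_wadd_of_feasible hfin hβ ENNReal.toReal_nonneg hτ
    (ENNReal.ofReal_toReal htop).ge hm hmγ
  rw [Real.log_div (hm0.trans_le hmγ).ne' hm0.ne'] at h
  have hlog : 0 ≤ Real.log γ - Real.log m := by linarith [Real.log_le_log hm0 hmγ]
  refine ENNReal.ofReal_le_of_le_toReal ?_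
  rw [div_le_iff₀ (by positivity)]
  have e : (Real.log γ - Real.log m) * (1 - (M.wadd τ).toReal / m)
      = (Real.log γ - Real.log m)
        - (M.wadd τ).toReal * ((Real.log γ - Real.log m) / m) := by field_simp
  rw [e] at h
  linarith

end SensorNetwork

end

theorem theorem6 {𝒳 : Type*} [MeasurableSpace 𝒳] {K n : ℕ} (M : SensorNetwork 𝒳 K n)
    (hfin : ∀ k, InformationTheory.klDiv (M.mixture (some k)) (M.mixture none) ≠ ⊤)
    (β : Fin K → ℝ) (hβ : M.IsOptimalWeight β) (hpos : 0 < M.weightedDiv β) :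
    (∀ γ : ℝ, 0 < γ → M.cusumTime β (Real.log γ) ∈ M.feasible γ) ∧
    Tendsto (fun γ : ℝ => M.wadd (M.cusumTime β (Real.log γ)) / ENNReal.ofReal (Real.log γ))
      atTop (𝓝 (M.weightedDiv β)⁻¹) ∧
    Tendsto (fun γ : ℝ => M.optimalWadd γ / ENNReal.ofReal (Real.log γ))
      atTop (𝓝 (M.weightedDiv β)⁻¹) ∧
    Tendsto (fun γ : ℝ => M.wadd (M.cusumTime β (Real.log γ)) / M.optimalWadd γ)
      atTop (𝓝 1) := by
  have hfeas : ∀ γ : ℝ, 0 < γ → M.cusumTime β (Real.log γ) ∈ M.feasible γ :=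
    fun γ hγ => M.cusumTime_mem_feasible hβ.1 hγ
  have hne := M.weightedDiv_ne_top hfin hβ
  set I : ℝ := (M.weightedDiv β).toReal with hIdef
  have hI : 0 < I := ENNReal.toReal_pos hpos.ne' hne
  have hinv : (M.weightedDiv β)⁻¹ = ENNReal.ofReal I⁻¹ := by
    rw [ENNReal.ofReal_inv_of_pos hI, ENNReal.ofReal_toReal hne]
  have hlog : ∀ᶠ γ : ℝ in atTop, 0 < Real.log γ :=
    Real.tendsto_log_atTop.eventually_gt_atTop 0
  have hopt_le : ∀ᶠ γ : ℝ in atTop, M.optimalWadd γ / ENNReal.ofReal (Real.log γ)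
      ≤ M.wadd (M.cusumTime β (Real.log γ)) / ENNReal.ofReal (Real.log γ) := by
    filter_upwards [eventually_gt_atTop 0] with γ hγ
    exact ENNReal.div_le_div_right (iInf₂_le _ (hfeas γ hγ)) _
  have hlower : ∀ a < (M.weightedDiv β)⁻¹, ∀ᶠ γ : ℝ in atTop,
      a < M.optimalWadd γ / ENNReal.ofReal (Real.log γ) := by
    intro a ha
    rw [hinv] at ha
    have hlim := (ENNReal.tendsto_ofReal (tendsto_lower_bound hI)).comp Real.tendsto_log_atTop
    -- Equivalent to the window being shorter than `γ`, as `le_optimalWadd` requires.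
    have hmle : ∀ᶠ γ : ℝ in atTop, Real.log (⌈Real.log γ ^ 2⌉₊ : ℝ) / Real.log γ < 1 :=
      (tendsto_log_ceil_sq_div.comp Real.tendsto_log_atTop).eventually_lt_const one_pos
    filter_upwards [hlim.eventually_const_lt ha, hmle, hlog, eventually_gt_atTop 0]
      with γ h1 h2 h3 h4
    refine h1.trans_le ?_
    have hm : 1 ≤ ⌈Real.log γ ^ 2⌉₊ := Nat.one_le_iff_ne_zero.2
      (Nat.ceil_pos.2 (by positivity)).ne'
    have hm0 : (0 : ℝ) < (⌈Real.log γ ^ 2⌉₊ : ℝ) := by exact_mod_cast hm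
    have hmγ : (⌈Real.log γ ^ 2⌉₊ : ℝ) ≤ γ := by
      rw [div_lt_one h3, Real.log_lt_log_iff hm0 h4] at h2
      exact h2.le
    simp only [Function.comp_apply]
    rw [ENNReal.ofReal_div_of_pos h3]
    exact ENNReal.div_le_div_right (M.le_optimalWadd hfin hβ hI hm hmγ) _
  have hupper : ∀ a > (M.weightedDiv β)⁻¹, ∀ᶠ γ : ℝ in atTop,
      M.wadd (M.cusumTime β (Real.log γ)) / ENNReal.ofReal (Real.log γ) < a := by
    intro a ha
    rw [hinv] at ha
    -- The truncation loss `δ` is fixed before `γ` grows, since the constant `c` depends on it.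
    obtain ⟨δ, hδ0, hδI, hδa⟩ : ∃ δ : ℝ, 0 < δ ∧ δ < I ∧ ENNReal.ofReal (I - δ)⁻¹ < a := by
      have hcont : Tendsto (fun δ : ℝ => ENNReal.ofReal (I - δ)⁻¹) (𝓝[>] 0)
          (𝓝 (ENNReal.ofReal I⁻¹)) := by
        refine ENNReal.tendsto_ofReal (Tendsto.inv₀ ?_ hI.ne')
        have : Tendsto (fun δ : ℝ => I - δ) (𝓝 0) (𝓝 (I - 0)) :=
          tendsto_const_nhds.sub tendsto_id
        rw [sub_zero] at this
        exact this.mono_left nhdsWithin_le_nhds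
      obtain ⟨δ, h1, h2, h3⟩ := ((hcont.eventually_lt_const ha).and
        ((Ioo_mem_nhdsGT hI : Set.Ioo (0 : ℝ) I ∈ 𝓝[>] 0))).exists
      exact ⟨δ, h2, h3, h1⟩
    obtain ⟨c, -, hc⟩ := M.exists_wadd_cusumTime_le hfin hβ hδ0 hδI
    have hlim := (ENNReal.tendsto_ofReal (tendsto_upper_bound c (sub_pos.2 hδI))).comp
      Real.tendsto_log_atTop
    filter_upwards [hlim.eventually_lt_const hδa, hlog, eventually_gt_atTop 1] with γ h1 h2 h3
    refine lt_of_le_of_lt ?_ h1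
    simp only [Function.comp_apply]
    rw [ENNReal.ofReal_div_of_pos h2]
    exact ENNReal.div_le_div_right (hc γ h3) _
  -- Both normalized delays are squeezed: the optimal one lies below that of the CuSum, the lower
  -- bound holds for the former and the upper bound for the latter.
  have hcusum : Tendsto (fun γ : ℝ => M.wadd (M.cusumTime β (Real.log γ))
      / ENNReal.ofReal (Real.log γ)) atTop (𝓝 (M.weightedDiv β)⁻¹) :=
    tendsto_order.2 ⟨fun a ha => by
      filter_upwards [hlower a ha, hopt_le] with γ h1 h2 using h1.trans_le h2, hupper⟩
  have hopt : Tendsto (fun γ : ℝ => M.optimalWadd γ / ENNReal.ofReal (Real.log γ))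
      atTop (𝓝 (M.weightedDiv β)⁻¹) :=
    tendsto_order.2 ⟨hlower, fun a ha => by
      filter_upwards [hupper a ha, hopt_le] with γ h1 h2 using h2.trans_lt h1⟩
  refine ⟨hfeas, hcusum, hopt, ?_⟩
  have h0 : (M.weightedDiv β)⁻¹ ≠ 0 := ENNReal.inv_ne_zero.2 hne
  have ht : (M.weightedDiv β)⁻¹ ≠ ⊤ := ENNReal.inv_ne_top.2 hpos.ne'
  have hdiv := ENNReal.Tendsto.div hcusum (Or.inl h0) hopt (Or.inl ht)
  rw [ENNReal.div_self h0 ht] at hdiv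
  refine hdiv.congr' ?_
  filter_upwards [hlog] with γ hγ
  rw [ENNReal.div_eq_inv_mul, ENNReal.div_eq_inv_mul (a := M.optimalWadd γ), mul_comm,
    mul_comm _ (M.optimalWadd γ)]
  exact ENNReal.mul_div_mul_right _ _ (ENNReal.inv_ne_zero.2 ENNReal.ofReal_ne_top)
    (ENNReal.inv_ne_top.2 (ENNReal.ofReal_pos.2 hγ).ne')
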